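/- Let $K$ and $k_0$ be fixed integers with $1\le k_0\le K$, let $\beta_0\in\mathbb R^K$ be a vector whose first $k_0$ coordinates are nonzero and whose remaining $K-k_0$ coordinates are zero, and let $\sigma_0^2>0$ and $M<\infty$. For each $n$ let $\mathbf X=\mathbf X_n$ be a (nonrandom) real $n\times K$ matrix with rows $\mathbf x_i$ and entries $x_{i,k}$, and let $\mathbf Y=\mathbf X\beta_0+\varepsilon$, where $\varepsilon=(\varepsilon_{1},\dots,\varepsilon_{n})^t$ (which may depend on $n$) has independent coordinates with $\mathbb E(\varepsilon_i)=0$, $\mathbb E(\varepsilon_i^2)=\sigma_0^2$ and $\mathbb E(\varepsilon_i^4)\le M$. Put $\Sigma_n=\mathbf X^t\mathbf X/n$ and assume, (D1) and (D3) for all sufficiently large $n$: - (D1) $\sum_{i=1}^n x_{i,k}=0$ and $\sum_{i=1}^n x_{i,k}^2=n$ for $k=1,\dots,K$; - (D2) $\max_{1\le i\le n}\|\mathbf x_i\|/\sqrt n\to0$; - (D3) $\mathbf X^t\mathbf X$ is positive definite; - (D4) $\Sigma_n\to\Sigma_0$ with $\Sigma_0$ positive definite. Let $\alpha_1,\dots,\alpha_K\in(0,1]$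 be fixed, and let $z_p$ be the upper $p$-quantile of $N(0,1)$, with $z_0=\infty$. Let $\hat\beta=(\mathbf X^t\mathbf X)^{-1}\mathbf X^t\mathbf Y$ and $\hat\sigma_n^2=\|\mathbf Y-\mathbf X\hat\beta\|^2/(n-K)$. Let $\mathbf X[k]$ consist of the first $k$ columns of $\mathbf X$, let $\hat\beta[k]=(\mathbf X[k]^t\mathbf X[k])^{-1}\mathbf X[k]^t\mathbf Y$, and let $s_{kk}[k]$ be the $k$th diagonal entry of $(\mathbf X[k]^t\mathbf X[k]/n)^{-1}$ and $s_{kk}$ that of $\Sigma_n^{-1}$. Put $$\tilde Z_{k}=\frac{n^{1/2}\hat\beta_k[k]}{\hat\sigma_n\, s_{kk}[k]^{1/2}},\qquad \hat Z_{k}=\frac{n^{1/2}\hat\beta_k}{\hat\sigma_n\, s_{kk}^{1/2}}\qquad(1\le k\le K),$$ with $\tilde Z_0=z_{\alpha_0/2}=0$, $\tilde Z_{K+1}=0$ and $\alpha_{K+1}=0$, and define $$\hat k_B=\max\{0\le k\le K:|\tilde Z_k|\ge z_{\alpha_k/2}\},\qquad \hat k_F=\min\{k-1:1\le k\le K+1,\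 |\tilde Z_k|<z_{\alpha_k/2}\},$$ $$\hat k_O=\#\{1\le k\le K:|\hat Z_k|\ge z_{\alpha_k/2}\}.$$ Then, as $n\to\infty$, $\hat k_B$ converges in distribution to a random variable $k_B$ such that, for $0\le k\le K$, $$\text{(a)}\quad \mathbb P\{k_B=k\}=\begin{cases}0,&k<k_0,\\ \prod_{j=k_0+1}^K(1-\alpha_j),&k=k_0,\\ \alpha_k\prod_{j=k+1}^K(1-\alpha_j),&k>k_0.\end{cases}$$ If moreover the design is orthogonal ($\Sigma_n=I$ for all sufficiently large $n$, and $\Sigma_0=I$), then $\hat k_F$ and $\hat k_O$ converge in distribution to random variables $k_F$ and $k_O$ such that, for $0\le k\le K$, $$\text{(b)}\quad \mathbb P\{k_F=k\}=\begin{cases}0,&k<k_0,\\ 1-\alpha_{k_0+1},&k=k_0,\\ (1-\alpha_{k+1})\,\alpha_{k_0+1}\cdots\alpha_k,&k>k_0,\end{cases}$$ $$\text{(c)}\quad \mathbb P\{k_O=k\}=\begin{cases}0,&k<k_0,\\ \mathbb P\{B_{k_0+1}+\cdots+B_K=k-k_0\},&k\ge k_0,\end{cases}$$ where $B_{k_0+1},\dots,B_K$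 are independent and $B_j$ is Bernoulli($\alpha_j$). -/

import Mathlib

open Filter Topology MeasureTheory ProbabilityTheory

noncomputable section

namespace Stepwise

/-- The upper `p`-quantile `z_p` of the standard normal law, i.e. its `100 (1 - p)` percentile:
the least `x` whose distribution function value is at least `1 - p` (for `0 < p < 1`). -/
def zUpper (p : ℝ) : ℝ := sInf {x : ℝ | 1 - p ≤ cdf (gaussianReal 0 1) x}

variable {n p K : ℕ}

/-- The normalized Gram matrix `Σ_n = Xᵗ X / n` of an `n × p` design matrix. -/
def gram (X : Matrix (Fin n) (Fin p) ℝ) : Matrix (Fin p) (Fin p) ℝ :=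
  (n : ℝ)⁻¹ • (X.transpose * X)

/-- The least squares estimator `(Xᵗ X)⁻¹ Xᵗ Y`. -/
def ols (X : Matrix (Fin n) (Fin p) ℝ) (Y : Fin n → ℝ) : Fin p → ℝ :=
  (X.transpose * X)⁻¹.mulVec (X.transpose.mulVec Y)

/-- The variance estimator of the full model, `‖Y - X β̂‖² / (n - K)`. -/
def sigmaHatSq (X : Matrix (Fin n) (Fin K) ℝ) (Y : Fin n → ℝ) : ℝ :=
  (∑ i, (Y i - X.mulVec (ols X Y) i) ^ 2) / ((n : ℝ) - (K : ℝ))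

/-- `X[k]`, the design matrix made of the first `k` columns of `X`. -/
def firstCols (X : Matrix (Fin n) (Fin K) ℝ) (k : ℕ) (hk : k ≤ K) : Matrix (Fin n) (Fin k) ℝ :=
  X.submatrix id (Fin.castLE hk)

/-- The full-model Z-statistic of coordinate `i`, with `s_{ii}` the `i`-th diagonal entry
of `Σ_n⁻¹`. -/
def zHat (X : Matrix (Fin n) (Fin K) ℝ) (Y : Fin n → ℝ) (i : Fin K) : ℝ :=
  Real.sqrt n * ols X Y i / (Real.sqrt (sigmaHatSq X Y) * Real.sqrt ((gram X)⁻¹ i i))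

/-- The stepwise test statistic `Z̃_k`, `k = i + 1`: the last coordinate of the least squares
estimator in the regression on the first `k` columns, standardized with the full-model `σ̂_n` and
the last diagonal entry of `(X[k]ᵗ X[k] / n)⁻¹`. -/
def zTilde (X : Matrix (Fin n) (Fin K) ℝ) (Y : Fin n → ℝ) (i : Fin K) : ℝ :=
  Real.sqrt n * ols (firstCols X (i + 1) i.isLt) Y (Fin.last i) /
    (Real.sqrt (sigmaHatSq X Y) *
      Real.sqrt ((gram (firstCols X (i + 1) i.isLt))⁻¹ (Fin.last i) (Fin.last i)))

/-- The backward stepwise complexity estimator `max {k : |Z̃_k| ≥ z_{α_k/2}, k = 0, …, K}`; the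
index `k = 0` always belongs to the set (`Z̃_0 = 0` and `z_{α_0/2} = 0`). -/
def kBackward (α : ℕ → ℝ) (X : Matrix (Fin n) (Fin K) ℝ) (Y : Fin n → ℝ) : ℕ :=
  sSup {k : ℕ | k = 0 ∨ ∃ i : Fin K, k = i + 1 ∧ zUpper (α k / 2) ≤ |zTilde X Y i|}

/-- The forward stepwise complexity estimator
`min {k - 1 : |Z̃_k| < z_{α_k/2}, k = 1, …, K + 1}`; the index `k = K + 1` always belongs to the
set (`Z̃_{K+1} = 0` and `z_{α_{K+1}/2} = z_0 = ∞`). -/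
def kForward (α : ℕ → ℝ) (X : Matrix (Fin n) (Fin K) ℝ) (Y : Fin n → ℝ) : ℕ :=
  sInf {j : ℕ | ∃ k : ℕ, j = k - 1 ∧
    (k = K + 1 ∨ ∃ i : Fin K, k = i + 1 ∧ |zTilde X Y i| < zUpper (α k / 2))}

/-- The OLS-hard complexity estimator: the number of coordinates `k = i + 1` whose full-model
Z-statistic satisfies `|Ẑ_k| ≥ z_{α_k/2}`. -/
def kOLSHard (α : ℕ → ℝ) (X : Matrix (Fin n) (Fin K) ℝ) (Y : Fin n → ℝ) : ℕ :=
  {i : Fin K | zUpper (α (i + 1) / 2) ≤ |zHat X Y i|}.ncard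

/-- The joint law of independent Bernoulli(`α_j`) variables `B_j`, `k₀ < j ≤ K`, with values in
`{0, 1} ⊆ ℕ`. -/
def bernoulliLaw (α : ℕ → unitInterval) (k₀ K : ℕ) : Measure (Finset.Ioc k₀ K → ℕ) :=
  Measure.pi fun j => bernoulliMeasure (1 : ℕ) 0 (α j)

end Stepwise

end

/-!
The statistic `Z̃_k` is the inner product of `Y` with a unit vector `u_k`, divided by `σ̂_n`, where
`u_k` is the normalized component of the `k`-th column of the design orthogonal to the preceding
columns (`zTilde_eq`, `sum_mul_stepDir`). The `u_k` are orthonormal for every design of full rank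
(`sum_stepDir_mul_stepDir`), so no orthogonality assumption is needed for the statistics of the
vanishing coefficients to be asymptotically independent: for `k > k₀` the mean `X β₀` is orthogonal
to `u_k`, and `⟨u_k, Y⟩ = ⟨u_k, ε⟩`. The entries of `u_k` tend to zero uniformly
(`exists_abs_stepDir_le`), hence Lévy's continuity theorem with a third-order bound on the
characteristic functions gives joint convergence of the `⟨u_k, ε⟩` to independent centered normal
variables of variance `σ₀²` (`tendstoInDistribution_orthonormal_sums`). Moreover `σ̂_n → σ₀` in
probability, by an `L¹` bound (`tendstoInMeasure_sqrt_sigmaHatSq`).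

Write the test `z_{α_k/2} ≤ |Z̃_k|` as `z_{α_k/2} σ̂_n ≤ |⟨u_k, Y⟩|`. Slutsky's theorem and the
portmanteau theorem then show that the vector of rejection indicators for `k₀ < k ≤ K` converges
in law to independent Bernoulli(`α_k`) variables (`tendsto_measureReal_nullPattern_mem`). The test
number `k₀` rejects with probability tending to one, because its noncentrality is of order `√n`;
when the design is orthogonal the same holds for all tests number `k ≤ k₀`, and `Ẑ_k = Z̃_k`
(`tendsto_measureReal_not_reject`, `zTilde_eq_zHat`). On the event that these tests reject, each
estimator is a function of the rejection pattern beyond `k₀` (`kBackward_eq_iff`,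
`kForward_eq_iff`, `kOLSHard_eq_add`), and the limiting point probabilities are masses of boxes or
of sums under the product Bernoulli law.
-/

namespace Stepwise

/-! ### A central limit theorem for weighted sums of independent errors -/

section CentralLimit

theorem norm_prod_sub_prod_le_sum {ι : Type*} (s : Finset ι) (f g : ι → ℂ)
    (hf : ∀ i ∈ s, ‖f i‖ ≤ 1) (hg : ∀ i ∈ s, ‖g i‖ ≤ 1) :
    ‖∏ i ∈ s, f i - ∏ i ∈ s, g i‖ ≤ ∑ i ∈ s, ‖f i - g i‖ := by
  classical
  induction s using Finset.induction_on with
  | empty => simp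
  | insert a s ha ih =>
    have hfs : ∀ i ∈ s, ‖f i‖ ≤ 1 := fun i hi => hf i (Finset.mem_insert_of_mem hi)
    have hgs : ∀ i ∈ s, ‖g i‖ ≤ 1 := fun i hi => hg i (Finset.mem_insert_of_mem hi)
    rw [Finset.prod_insert ha, Finset.prod_insert ha, Finset.sum_insert ha]
    have h1 : ‖∏ i ∈ s, f i‖ ≤ 1 := by
      rw [norm_prod]
      exact Finset.prod_le_one (fun i _ => norm_nonneg _) hfs
    have h2 : ‖g a‖ ≤ 1 := hg a (Finset.mem_insert_self _ _)
    calc ‖f a * ∏ i ∈ s, f i - g a * ∏ i ∈ s, g i‖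
        = ‖(f a - g a) * ∏ i ∈ s, f i + g a * (∏ i ∈ s, f i - ∏ i ∈ s, g i)‖ := by ring_nf
      _ ≤ ‖f a - g a‖ * ‖∏ i ∈ s, f i‖ + ‖g a‖ * ‖∏ i ∈ s, f i - ∏ i ∈ s, g i‖ :=
          (norm_add_le _ _).trans_eq (by rw [norm_mul, norm_mul])
      _ ≤ ‖f a - g a‖ * 1 + 1 * ∑ i ∈ s, ‖f i - g i‖ := by
          gcongr
          exact ih hfs hgs
      _ = _ := by ring

theorem norm_exp_mul_I_sub_le (x : ℝ) :
    ‖Complex.exp (x * Complex.I) - (1 + x * Complex.I - (x : ℂ) ^ 2 / 2)‖ ≤ 4 * |x| ^ 3 := by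
  have hx : ‖(x * Complex.I : ℂ)‖ = |x| := by simp
  rcases le_total |x| 1 with h | h
  · have := Complex.exp_bound (x := x * Complex.I) (by rw [hx]; exact h) (n := 3) (by norm_num)
    rw [hx] at this
    have h2 : ∑ m ∈ Finset.range 3, (x * Complex.I : ℂ) ^ m / (m.factorial : ℂ)
        = 1 + x * Complex.I - (x : ℂ) ^ 2 / 2 := by
      simp [Finset.sum_range_succ, mul_pow, Nat.factorial]
      ring
    rw [h2] at this
    refine this.trans ?_
    have h3 : (0 : ℝ) ≤ |x| ^ 3 := by positivity
    have : ((Nat.succ 3 : ℕ) : ℝ) * (((Nat.factorial 3 : ℕ) : ℝ) * ((3 : ℕ) : ℝ))⁻¹ ≤ 4 := by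
      norm_num [Nat.factorial]
    nlinarith
  · have h1 : ‖Complex.exp (x * Complex.I)‖ = 1 := Complex.norm_exp_ofReal_mul_I x
    have h2 : ‖((x : ℂ) ^ 2 / 2)‖ = |x| ^ 2 / 2 := by simp
    have h3 : 1 ≤ |x| ^ 3 := one_le_pow₀ h
    have h4 : |x| ≤ |x| ^ 3 := le_self_pow₀ h (by norm_num)
    have h5 : |x| ^ 2 ≤ |x| ^ 3 := pow_le_pow_right₀ h (by norm_num)
    calc ‖Complex.exp (x * Complex.I) - (1 + x * Complex.I - (x : ℂ) ^ 2 / 2)‖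
        ≤ ‖Complex.exp (x * Complex.I)‖ + (‖(1 : ℂ)‖ + ‖(x * Complex.I : ℂ)‖
          + ‖((x : ℂ) ^ 2 / 2)‖) := by
          refine (norm_sub_le _ _).trans (add_le_add le_rfl ((norm_sub_le _ _).trans ?_))
          exact add_le_add (norm_add_le _ _) le_rfl
      _ = 1 + (1 + |x| + |x| ^ 2 / 2) := by rw [h1, hx, h2]; simp
      _ ≤ 4 * |x| ^ 3 := by linarith

theorem abs_exp_neg_sub_le {y : ℝ} (hy : 0 ≤ y) : |Real.exp (-y) - (1 - y)| ≤ y ^ 2 := by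
  rcases le_total y 1 with h | h
  · have := Real.abs_exp_sub_one_sub_id_le (x := -y) (by rwa [abs_neg, abs_of_nonneg hy])
    rw [neg_sq] at this
    convert this using 2
    ring
  · have h1 : Real.exp (-y) ≤ 1 := Real.exp_le_one_iff.2 (by linarith)
    have h2 := Real.add_one_le_exp (-y)
    rw [abs_le]
    constructor <;> nlinarith

variable {Ω : Type*} [MeasurableSpace Ω] {P : Measure Ω} [IsProbabilityMeasure P]

theorem memLp_two_of_four {X : Ω → ℝ} (hX : MemLp X 4 P) : MemLp X 2 P :=
  hX.mono_exponent (by norm_num)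

omit [IsProbabilityMeasure P] in
theorem integrable_pow_four {X : Ω → ℝ} (hX : MemLp X 4 P) :
    Integrable (fun ω => X ω ^ 4) P := by
  have := hX.integrable_norm_pow (p := 4) (by norm_num)
  simpa [Even.pow_abs (by decide : Even 4)] using this

/-- The quadratic expansion of a characteristic function, with a remainder that is uniform over
all laws with the given bound on the fourth moment. -/
theorem norm_charFun_sub_le {X : Ω → ℝ} (hXm : Measurable X) (hX : MemLp X 4 P) {s M : ℝ}
    (h1 : ∫ ω, X ω ∂P = 0) (h2 : ∫ ω, X ω ^ 2 ∂P = s ^ 2) (h4 : ∫ ω, X ω ^ 4 ∂P ≤ M) (a : ℝ) :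
    ‖charFun (P.map X) a - (1 - ((s ^ 2 * a ^ 2 / 2 : ℝ) : ℂ))‖ ≤ 4 * (1 + M) * |a| ^ 3 := by
  have i1 : Integrable X P := hX.integrable (by norm_num)
  have i2 : Integrable (fun ω => X ω ^ 2) P := (memLp_two_of_four hX).integrable_sq
  have i4 : Integrable (fun ω => X ω ^ 4) P := integrable_pow_four hX
  have ie : Integrable (fun ω => Complex.exp ((a * X ω : ℝ) * Complex.I)) P := by
    refine (integrable_const (1 : ℝ)).mono' (by fun_prop) (ae_of_all _ fun ω => ?_)
    rw [Complex.norm_exp_ofReal_mul_I]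
  have i1' : Integrable (fun ω => ((a * X ω : ℝ) : ℂ) * Complex.I) P :=
    ((i1.const_mul a).ofReal).mul_const _
  have i2' : Integrable (fun ω => ((a * X ω : ℝ) : ℂ) ^ 2 / 2) P := by
    have : Integrable (fun ω => ((a ^ 2 / 2 * X ω ^ 2 : ℝ) : ℂ)) P := (i2.const_mul _).ofReal
    refine this.congr (ae_of_all _ fun ω => ?_)
    push_cast
    ring
  have e1 : ∫ ω, ((a * X ω : ℝ) : ℂ) * Complex.I ∂P = 0 := by
    rw [integral_mul_const, integral_complex_ofReal, integral_const_mul, h1]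
    simp
  have e2 : ∫ ω, ((a * X ω : ℝ) : ℂ) ^ 2 / 2 ∂P = ((s ^ 2 * a ^ 2 / 2 : ℝ) : ℂ) := by
    have : ∀ ω, ((a * X ω : ℝ) : ℂ) ^ 2 / 2 = ((a ^ 2 / 2 * X ω ^ 2 : ℝ) : ℂ) := fun ω => by
      push_cast
      ring
    simp_rw [this]
    rw [integral_complex_ofReal, integral_const_mul, h2]
    congr 1
    ring
  have i3 : Integrable (fun ω => (1 : ℂ) + ((a * X ω : ℝ) : ℂ) * Complex.I) P :=
    (integrable_const _).add i1'
  have i5 : Integrable (fun ω => (1 : ℂ) + ((a * X ω : ℝ) : ℂ) * Complex.I -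
      ((a * X ω : ℝ) : ℂ) ^ 2 / 2) P := i3.sub i2'
  have key : charFun (P.map X) a - (1 - ((s ^ 2 * a ^ 2 / 2 : ℝ) : ℂ)) =
      ∫ ω, (Complex.exp ((a * X ω : ℝ) * Complex.I) -
        (1 + ((a * X ω : ℝ) : ℂ) * Complex.I - ((a * X ω : ℝ) : ℂ) ^ 2 / 2)) ∂P := by
    rw [integral_sub ie i5, integral_sub i3 i2', integral_add (integrable_const _) i1',
      e1, e2, charFun_apply_real, integral_map hXm.aemeasurable (by fun_prop)]
    simp
  rw [key]
  calc _ ≤ ∫ ω, 4 * |a| ^ 3 * (1 + X ω ^ 4) ∂P := by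
        refine norm_integral_le_of_norm_le (((integrable_const _).add i4).const_mul _)
          (ae_of_all _ fun ω => (norm_exp_mul_I_sub_le (a * X ω)).trans ?_)
        have : |X ω| ^ 3 ≤ 1 + X ω ^ 4 := by
          rw [← Even.pow_abs (by decide : Even 4) (X ω)]
          rcases le_total |X ω| 1 with h | h
          · have := pow_le_one₀ (n := 3) (abs_nonneg _) h
            nlinarith [pow_nonneg (abs_nonneg (X ω)) 4]
          · have := pow_le_pow_right₀ h (by norm_num : 3 ≤ 4)
            linarith
        rw [abs_mul, mul_pow, ← mul_assoc]
        gcongr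
    _ = 4 * |a| ^ 3 * (1 + ∫ ω, X ω ^ 4 ∂P) := by
        rw [integral_const_mul, integral_add (integrable_const _) i4]
        simp
    _ ≤ 4 * |a| ^ 3 * (1 + M) := by gcongr
    _ = _ := by ring

/-- Lyapunov's comparison of a weighted sum of independent errors with the normal law: only the
sum of squares of the weights and the largest weight enter. -/
theorem norm_prod_charFun_sub_le {κ : Type*} [Fintype κ] {X : κ → Ω → ℝ}
    (hXm : ∀ i, Measurable (X i)) (hX : ∀ i, MemLp (X i) 4 P) {s M c : ℝ}
    (h1 : ∀ i, ∫ ω, X i ω ∂P = 0) (h2 : ∀ i, ∫ ω, X i ω ^ 2 ∂P = s ^ 2)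
    (h4 : ∀ i, ∫ ω, X i ω ^ 4 ∂P ≤ M) (hM : 0 ≤ M) (a : κ → ℝ)
    (hac : ∀ i, |a i| ≤ c) :
    ‖∏ i, charFun (P.map (X i)) (a i) - Real.exp (-(s ^ 2 * (∑ i, a i ^ 2) / 2))‖ ≤
      (4 * (1 + M) * c + s ^ 4 / 4 * c ^ 2) * ∑ i, a i ^ 2 := by
  have he : ((Real.exp (-(s ^ 2 * (∑ i, a i ^ 2) / 2)) : ℝ) : ℂ)
      = ∏ i, ((Real.exp (-(s ^ 2 * a i ^ 2 / 2)) : ℝ) : ℂ) := by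
    rw [← Complex.ofReal_prod, ← Real.exp_sum]
    congr 2
    rw [Finset.sum_neg_distrib, ← Finset.sum_div, ← Finset.mul_sum]
  rw [he, Finset.mul_sum]
  have := fun i => Measure.isProbabilityMeasure_map (hXm i).aemeasurable (μ := P)
  refine (norm_prod_sub_prod_le_sum _ _ _ (fun i _ => norm_charFun_le_one _)
    (fun i _ => ?_)).trans (Finset.sum_le_sum fun i _ => ?_)
  · rw [Complex.norm_real, Real.norm_of_nonneg (Real.exp_pos _).le, Real.exp_le_one_iff]
    simp only [Left.neg_nonpos_iff]
    positivity
  · have e1 := norm_charFun_sub_le (hXm i) (hX i) (h1 i) (h2 i) (h4 i) (a i)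
    have e2 := abs_exp_neg_sub_le (y := s ^ 2 * a i ^ 2 / 2) (by positivity)
    have e3 : ‖((Real.exp (-(s ^ 2 * a i ^ 2 / 2)) : ℝ) : ℂ) -
        (1 - ((s ^ 2 * a i ^ 2 / 2 : ℝ) : ℂ))‖ ≤ (s ^ 2 * a i ^ 2 / 2) ^ 2 := by
      rw [← Complex.ofReal_one, ← Complex.ofReal_sub, ← Complex.ofReal_sub, Complex.norm_real]
      exact e2
    have e4 : |a i| ^ 3 ≤ c * a i ^ 2 := by
      rw [pow_succ', sq_abs]
      exact mul_le_mul_of_nonneg_right (hac i) (sq_nonneg _)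
    have e5 : a i ^ 2 ≤ c ^ 2 := sq_le_sq' (by linarith [neg_abs_le (a i), hac i])
      ((le_abs_self _).trans (hac i))
    calc ‖charFun (P.map (X i)) (a i) - ((Real.exp (-(s ^ 2 * a i ^ 2 / 2)) : ℝ) : ℂ)‖
        ≤ ‖charFun (P.map (X i)) (a i) - (1 - ((s ^ 2 * a i ^ 2 / 2 : ℝ) : ℂ))‖
          + ‖((Real.exp (-(s ^ 2 * a i ^ 2 / 2)) : ℝ) : ℂ) -
            (1 - ((s ^ 2 * a i ^ 2 / 2 : ℝ) : ℂ))‖ := by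
          rw [norm_sub_rev ((Real.exp (-(s ^ 2 * a i ^ 2 / 2)) : ℝ) : ℂ)]
          exact norm_sub_le_norm_sub_add_norm_sub _ _ _
      _ ≤ 4 * (1 + M) * |a i| ^ 3 + (s ^ 2 * a i ^ 2 / 2) ^ 2 := add_le_add e1 e3
      _ = 4 * (1 + M) * |a i| ^ 3 + s ^ 4 / 4 * a i ^ 2 * a i ^ 2 := by ring
      _ ≤ 4 * (1 + M) * (c * a i ^ 2) + s ^ 4 / 4 * c ^ 2 * a i ^ 2 := by gcongr
      _ = _ := by ring

/-- Central limit theorem for the coordinates of a noise vector along orthonormal directions whose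
entries are uniformly small. -/
theorem tendstoInDistribution_orthonormal_sums {ι : Type*} [Fintype ι] [DecidableEq ι]
    {ε : (n : ℕ) → Fin n → Ω → ℝ} {s M : ℝ}
    (hεm : ∀ n i, Measurable (ε n i)) (hεi : ∀ n, iIndepFun (ε n) P)
    (hε4 : ∀ n i, MemLp (ε n i) 4 P) (h1 : ∀ n i, ∫ ω, ε n i ω ∂P = 0)
    (h2 : ∀ n i, ∫ ω, ε n i ω ^ 2 ∂P = s ^ 2) (hM : ∀ n i, ∫ ω, ε n i ω ^ 4 ∂P ≤ M)
    {u : (n : ℕ) → ι → Fin n → ℝ}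
    (hu : ∀ᶠ n in atTop, ∀ j l, ∑ i, u n j i * u n l i = if j = l then 1 else 0)
    {c : ℕ → ℝ} (hc : Tendsto c atTop (𝓝 0)) (huc : ∀ᶠ n in atTop, ∀ j i, |u n j i| ≤ c n) :
    TendstoInDistribution (fun n ω j => ∑ i, u n j i * ε n i ω) atTop
      (fun (x : ι → ℝ) j => s * x j) (fun _ => P) (Measure.pi fun _ => gaussianReal 0 1) := by
  have hM0 : 0 ≤ M := (integral_nonneg fun ω => by positivity).trans (hM 1 0)
  have hm : ∀ n, Measurable fun ω => WithLp.toLp 2 (fun j => ∑ i, u n j i * ε n i ω) := fun n => by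
    have := hεm n
    fun_prop
  suffices h : TendstoInDistribution
      (fun n ω => WithLp.toLp 2 (fun j => ∑ i, u n j i * ε n i ω)) atTop
      (fun (x : ι → ℝ) => s • WithLp.toLp 2 x) (fun _ => P)
      (Measure.pi fun _ => gaussianReal 0 1) by
    exact h.continuous_comp (PiLp.continuous_ofLp 2 _)
  refine ⟨fun n => (hm n).aemeasurable, by fun_prop, ?_⟩
  refine ProbabilityMeasure.tendsto_iff_tendsto_charFun.2 fun t => ?_
  have hlim : charFun ((Measure.pi fun _ => gaussianReal 0 1).map
      (fun (x : ι → ℝ) => s • WithLp.toLp 2 x)) t =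
      (Real.exp (-(s ^ 2 * (∑ j, t j ^ 2) / 2)) : ℝ) := by
    rw [charFun_map_smul_comp (by fun_prop), charFun_pi]
    simp_rw [charFun_gaussianReal]
    rw [← Complex.exp_sum]
    push_cast
    congr 1
    rw [Finset.mul_sum, Finset.sum_div, ← Finset.sum_neg_distrib]
    refine Finset.sum_congr rfl fun j _ => ?_
    simp
    ring
  simp only [ProbabilityMeasure.coe_mk]
  rw [hlim]
  set a : (n : ℕ) → Fin n → ℝ := fun n i => ∑ j, t j * u n j i with ha
  have hchar : ∀ n, charFun (P.map fun ω => WithLp.toLp 2 (fun j => ∑ i, u n j i * ε n i ω)) t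
      = ∏ i, charFun (P.map (ε n i)) (a n i) := fun n => by
    have e1 : ∏ i, charFun (P.map (ε n i)) (a n i)
        = charFun (P.map (∑ i, fun ω => a n i * ε n i ω)) 1 := by
      rw [iIndepFun.charFun_map_sum_eq_prod (fun i => ((hεm n i).const_mul _).aemeasurable)
        ((hεi n).comp (fun i x => a n i * x) (fun i => by fun_prop)), Finset.prod_apply]
      refine Finset.prod_congr rfl fun i _ => ?_
      rw [charFun_map_mul_comp (hεm n i).aemeasurable, mul_one]
    rw [e1, charFun_apply, charFun_apply, integral_map (hm n).aemeasurable (by fun_prop),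
      integral_map (by have := hεm n; fun_prop) (by fun_prop)]
    congr 1
    ext ω
    congr 3
    simp only [PiLp.inner_apply, RCLike.inner_apply, conj_trivial, Finset.sum_apply, ha, one_mul]
    simp_rw [Finset.mul_sum, Finset.sum_mul]
    rw [Finset.sum_comm]
    exact Finset.sum_congr rfl fun i _ => Finset.sum_congr rfl fun j _ => by ring
  simp_rw [hchar]
  rw [tendsto_iff_norm_sub_tendsto_zero]
  set T := ∑ j, |t j| with hT
  have hasq : ∀ᶠ n in atTop, ∑ i, a n i ^ 2 = ∑ j, t j ^ 2 := by
    filter_upwards [hu] with n hn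
    calc ∑ i, a n i ^ 2 = ∑ i, ∑ j, ∑ l, t j * t l * (u n j i * u n l i) := by
          refine Finset.sum_congr rfl fun i _ => ?_
          rw [sq, ha, Finset.sum_mul_sum]
          exact Finset.sum_congr rfl fun _ _ => Finset.sum_congr rfl fun _ _ => by ring
      _ = ∑ j, ∑ l, t j * t l * ∑ i, u n j i * u n l i := by
          rw [Finset.sum_comm]
          refine Finset.sum_congr rfl fun j _ => ?_
          rw [Finset.sum_comm]
          simp_rw [Finset.mul_sum]
      _ = _ := by
          simp_rw [hn]
          simp [sq]
  have hbound : ∀ᶠ n in atTop, ‖∏ i, charFun (P.map (ε n i)) (a n i) -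
      (Real.exp (-(s ^ 2 * (∑ j, t j ^ 2) / 2)) : ℝ)‖ ≤
      (4 * (1 + M) * (T * |c n|) + s ^ 4 / 4 * (T * |c n|) ^ 2) * ∑ j, t j ^ 2 := by
    filter_upwards [hasq, huc] with n hn hcn
    rw [← hn]
    refine norm_prod_charFun_sub_le (hεm n) (hε4 n) (h1 n) (h2 n) (hM n) hM0 _ fun i => ?_
    rw [hT, Finset.sum_mul]
    refine (Finset.abs_sum_le_sum_abs _ _).trans (Finset.sum_le_sum fun j _ => ?_)
    rw [abs_mul]
    exact mul_le_mul_of_nonneg_left ((hcn j i).trans (le_abs_self _)) (abs_nonneg _)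
  refine squeeze_zero' (Eventually.of_forall fun _ => norm_nonneg _) hbound ?_
  have hc' : Tendsto (fun n => T * |c n|) atTop (𝓝 0) := by
    simpa using hc.abs.const_mul T
  simpa using (((hc'.const_mul (4 * (1 + M))).add
    ((hc'.pow 2).const_mul (s ^ 4 / 4))).mul_const (∑ j, t j ^ 2))

end CentralLimit

/-! ### Consistency of the variance estimator -/

section Moments

variable {Ω : Type*} [MeasurableSpace Ω] {P : Measure Ω} [IsProbabilityMeasure P]

omit [IsProbabilityMeasure P] in
theorem memLp_sq_of_four {X : Ω → ℝ} (hX : MemLp X 4 P) : MemLp (fun ω => X ω ^ 2) 2 P := by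
  rw [memLp_two_iff_integrable_sq (by exact hX.1.pow 2)]
  simpa [← pow_mul] using integrable_pow_four hX

theorem integral_sum_mul_sq {κ : Type*} [Fintype κ] {X : κ → Ω → ℝ}
    (hX : ∀ i, MemLp (X i) 2 P) (hi : iIndepFun X P) {s : ℝ} (h1 : ∀ i, ∫ ω, X i ω ∂P = 0)
    (h2 : ∀ i, ∫ ω, X i ω ^ 2 ∂P = s ^ 2) (a : κ → ℝ) :
    ∫ ω, (∑ i, a i * X i ω) ^ 2 ∂P = s ^ 2 * ∑ i, a i ^ 2 := by
  have hm : ∀ i, MemLp (fun ω => a i * X i ω) 2 P := fun i => (hX i).const_mul (a i)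
  have hv := IndepFun.variance_sum (X := fun i ω => a i * X i ω) (μ := P) (s := Finset.univ)
    (fun i _ => hm i) (fun i _ j _ hij =>
      (hi.comp (fun i x => a i * x) (fun i => by fun_prop)).indepFun hij)
  have h0 : ∫ ω, (∑ i, fun ω => a i * X i ω) ω ∂P = 0 := by
    simp only [Finset.sum_apply]
    rw [integral_finsetSum _ fun i _ => (hm i).integrable (by norm_num)]
    simp [integral_const_mul, h1]
  rw [variance_of_integral_eq_zero (memLp_finsetSum' _ fun i _ => hm i).aemeasurable h0] at hv
  simp only [Finset.sum_apply] at hv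
  rw [hv, Finset.mul_sum]
  refine Finset.sum_congr rfl fun i _ => ?_
  rw [variance_const_mul, variance_of_integral_eq_zero (hX i).aemeasurable (h1 i), h2]
  ring

theorem integral_mean_sq_sub_sq_le {n : ℕ} (hn : 0 < n) {X : Fin n → Ω → ℝ}
    (hX : ∀ i, MemLp (X i) 4 P) (hi : iIndepFun X P) {s M : ℝ}
    (h2 : ∀ i, ∫ ω, X i ω ^ 2 ∂P = s ^ 2) (h4 : ∀ i, ∫ ω, X i ω ^ 4 ∂P ≤ M) :
    ∫ ω, ((∑ i, X i ω ^ 2) / n - s ^ 2) ^ 2 ∂P ≤ M / n := by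
  have hm : ∀ i, MemLp (fun ω => X i ω ^ 2) 2 P := fun i => memLp_sq_of_four (hX i)
  have hv := IndepFun.variance_sum (X := fun i ω => X i ω ^ 2) (μ := P) (s := Finset.univ)
    (fun i _ => hm i) (fun i _ j _ hij =>
      (hi.comp (fun i x => x ^ 2) (fun i => by fun_prop)).indepFun hij)
  have hmean : ∫ ω, (∑ i, fun ω => X i ω ^ 2) ω ∂P = n * s ^ 2 := by
    simp only [Finset.sum_apply]
    rw [integral_finsetSum _ fun i _ => (hm i).integrable (by norm_num)]
    simp [h2]
  rw [variance_eq_integral (memLp_finsetSum' _ fun i _ => hm i).aemeasurable, hmean] at hv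
  simp only [Finset.sum_apply] at hv
  have hn' : (0 : ℝ) < n := by exact_mod_cast hn
  have hle : ∑ i, Var[fun ω => X i ω ^ 2; P] ≤ n * M := by
    calc ∑ i, Var[fun ω => X i ω ^ 2; P] ≤ ∑ _i : Fin n, M := by
          refine Finset.sum_le_sum fun i _ => (variance_le_expectation_sq (hm i).1).trans ?_
          simpa [← pow_mul] using h4 i
      _ = n * M := by simp
  calc ∫ ω, ((∑ i, X i ω ^ 2) / n - s ^ 2) ^ 2 ∂P
      = ∫ ω, ((n : ℝ) ^ 2)⁻¹ * (∑ i, X i ω ^ 2 - n * s ^ 2) ^ 2 ∂P := by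
        congr 1
        ext ω
        field_simp
    _ = ((n : ℝ) ^ 2)⁻¹ * ∑ i, Var[fun ω => X i ω ^ 2; P] := by rw [integral_const_mul, hv]
    _ ≤ ((n : ℝ) ^ 2)⁻¹ * (n * M) := by gcongr
    _ = M / n := by field_simp

theorem tendstoInMeasure_of_abs_sub_le {f g : ℕ → Ω → ℝ} {c : ℝ}
    (hg : ∀ᶠ n in atTop, Integrable (g n) P) (hfg : ∀ᶠ n in atTop, ∀ ω, |f n ω - c| ≤ g n ω)
    {b : ℕ → ℝ} (hb : ∀ᶠ n in atTop, ∫ ω, g n ω ∂P ≤ b n) (hb0 : Tendsto b atTop (𝓝 0)) :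
    TendstoInMeasure P f atTop fun _ => c := by
  rw [tendstoInMeasure_iff_measureReal_norm]
  intro δ hδ
  refine squeeze_zero' (Eventually.of_forall fun _ => measureReal_nonneg) ?_
    (by simpa using hb0.div_const δ)
  filter_upwards [hg, hfg, hb] with n h1 h2 h3
  rw [le_div_iff₀ hδ, mul_comm]
  refine le_trans ?_ ((mul_meas_ge_le_integral_of_nonneg
    (ae_of_all _ fun ω => (abs_nonneg _).trans (h2 ω)) h1 δ).trans h3)
  exact mul_le_mul_of_nonneg_left
    (measureReal_mono fun ω (hω : δ ≤ _) => hω.trans (h2 ω)) hδ.le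

end Moments

section Residual

open Matrix

variable {n K : ℕ}

theorem ols_eq_add {X : Matrix (Fin n) (Fin K) ℝ} (hX : (Xᵀ * X).PosDef) (β : Fin K → ℝ)
    (e : Fin n → ℝ) : ols X (fun i => X.mulVec β i + e i) = β + (Xᵀ * X)⁻¹ *ᵥ (Xᵀ *ᵥ e) := by
  have hdet : IsUnit (Xᵀ * X).det := (Matrix.isUnit_iff_isUnit_det _).1 hX.isUnit
  have h : (fun i => X.mulVec β i + e i) = X *ᵥ β + e := rfl
  rw [ols, h, mulVec_add, mulVec_mulVec, mulVec_add, mulVec_mulVec, nonsing_inv_mul _ hdet,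
    one_mulVec]

theorem inv_transpose_mul_self (hn : n ≠ 0) {X : Matrix (Fin n) (Fin K) ℝ}
    (hX : (Xᵀ * X).PosDef) : (Xᵀ * X)⁻¹ = (n : ℝ)⁻¹ • (gram X)⁻¹ := by
  have hdet : IsUnit (Xᵀ * X).det := (Matrix.isUnit_iff_isUnit_det _).1 hX.isUnit
  have hn' : (n : ℝ) ≠ 0 := by exact_mod_cast hn
  have : Invertible ((n : ℝ)⁻¹) := invertibleOfNonzero (inv_ne_zero hn')
  rw [gram, Matrix.inv_smul _ _ hdet, invOf_eq_inv, smul_smul, inv_inv, inv_mul_cancel₀ hn',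
    one_smul]

/-- The residual sum of squares is the error sum of squares minus a quadratic form in the
averages `n⁻¹ Xᵗ e`. -/
theorem sigmaHatSq_eq (hn : n ≠ 0) {X : Matrix (Fin n) (Fin K) ℝ} (hX : (Xᵀ * X).PosDef)
    (β : Fin K → ℝ) (e : Fin n → ℝ) :
    sigmaHatSq X (fun i => X.mulVec β i + e i) =
      (∑ i, e i ^ 2 - n * ∑ j, ∑ l, (gram X)⁻¹ j l *
        ((∑ i, X i j / n * e i) * ∑ i, X i l / n * e i)) / (n - K) := by
  have hdet : IsUnit (Xᵀ * X).det := (Matrix.isUnit_iff_isUnit_det _).1 hX.isUnit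
  have hn' : (n : ℝ) ≠ 0 := by exact_mod_cast hn
  set b := Xᵀ *ᵥ e with hb
  set g := (Xᵀ * X)⁻¹ *ᵥ b with hg
  have hw : ∀ j, ∑ i, X i j / n * e i = (n : ℝ)⁻¹ * b j := fun j => by
    simp only [hb, mulVec, dotProduct, transpose_apply, Finset.mul_sum]
    exact Finset.sum_congr rfl fun i _ => by ring
  have hols : ols X (fun i => X.mulVec β i + e i) = β + g := ols_eq_add hX β e
  rw [sigmaHatSq, hols]
  congr 1
  have h1 : ∀ i, X.mulVec β i + e i - X.mulVec (β + g) i = (e - X *ᵥ g) i := fun i => by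
    rw [mulVec_add]
    simp only [Pi.add_apply, Pi.sub_apply]
    ring
  have h2 : ∑ i, (e - X *ᵥ g) i ^ 2 = (e - X *ᵥ g) ⬝ᵥ (e - X *ᵥ g) := by
    simp [dotProduct, sq]
  have h3 : e ⬝ᵥ (X *ᵥ g) = b ⬝ᵥ g := by
    rw [dotProduct_mulVec, hb, mulVec_transpose]
  have h4 : (X *ᵥ g) ⬝ᵥ (X *ᵥ g) = b ⬝ᵥ g := by
    rw [dotProduct_mulVec, ← mulVec_transpose, mulVec_mulVec, hg, mulVec_mulVec,
      mul_nonsing_inv _ hdet, one_mulVec]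
  simp_rw [h1]
  rw [h2, sub_dotProduct, dotProduct_sub, dotProduct_sub, dotProduct_comm (X *ᵥ g) e, h3, h4]
  have h5 : b ⬝ᵥ g = n * ∑ j, ∑ l, (gram X)⁻¹ j l *
        ((∑ i, X i j / n * e i) * ∑ i, X i l / n * e i) := by
    have h6 : b ⬝ᵥ g = ∑ j, b j * ∑ l, (Xᵀ * X)⁻¹ j l * b l := rfl
    rw [h6, inv_transpose_mul_self hn hX, Finset.mul_sum]
    refine Finset.sum_congr rfl fun j _ => ?_
    rw [Finset.mul_sum, Finset.mul_sum]
    refine Finset.sum_congr rfl fun l _ => ?_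
    rw [hw, hw, Matrix.smul_apply, smul_eq_mul]
    field_simp
  rw [← h5]
  simp [dotProduct, sq]

end Residual

open Matrix in
/-- `σ̂_n` converges to the error standard deviation in probability. The fourth moments control
the average of the squared errors, and fitting the `K` columns costs `O(1 / n)` in mean. -/
theorem tendstoInMeasure_sqrt_sigmaHatSq {Ω : Type*} [MeasurableSpace Ω] {P : Measure Ω}
    [IsProbabilityMeasure P] {K : ℕ} (β : Fin K → ℝ)
    {X : (n : ℕ) → Matrix (Fin n) (Fin K) ℝ} {S₀ : Matrix (Fin K) (Fin K) ℝ}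
    (hX2 : ∀ᶠ n in atTop, ∀ k, ∑ i, X n i k ^ 2 = (n : ℝ))
    (hX : ∀ᶠ n in atTop, ((X n)ᵀ * X n).PosDef)
    (hG : Tendsto (fun n => (gram (X n))⁻¹) atTop (𝓝 S₀))
    {ε : (n : ℕ) → Fin n → Ω → ℝ} {s M : ℝ} (hs : 0 < s)
    (hεi : ∀ n, iIndepFun (ε n) P) (hε4 : ∀ n i, MemLp (ε n i) 4 P)
    (h1 : ∀ n i, ∫ ω, ε n i ω ∂P = 0) (h2 : ∀ n i, ∫ ω, ε n i ω ^ 2 ∂P = s ^ 2)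
    (hM : ∀ n i, ∫ ω, ε n i ω ^ 4 ∂P ≤ M) :
    TendstoInMeasure P
      (fun n ω => √(sigmaHatSq (X n) fun i => (X n).mulVec β i + ε n i ω)) atTop
      (fun _ => s) := by
  set w : (n : ℕ) → Fin K → Ω → ℝ := fun n j ω => ∑ i, X n i j / n * ε n i ω with hw
  set m : ℕ → Ω → ℝ := fun n ω => (∑ i, ε n i ω ^ 2) / n - s ^ 2 with hm
  set C : ℕ → ℝ := fun n => ∑ j, ∑ l, |(gram (X n))⁻¹ j l| with hC
  set r : ℕ → ℝ := fun n => (n : ℝ) / (n - K) with hr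
  have hwL : ∀ n j, MemLp (w n j) 2 P := fun n j =>
    memLp_finsetSum _ fun i _ => (memLp_two_of_four (hε4 n i)).const_mul _
  have hmL : ∀ n, MemLp (m n) 2 P := fun n => by
    have h := (memLp_finsetSum Finset.univ fun i _ =>
      memLp_sq_of_four (hε4 n i)).const_mul (n : ℝ)⁻¹
    refine (h.sub (memLp_const (s ^ 2))).ae_eq (ae_of_all _ fun ω => ?_)
    simp only [hm, Pi.sub_apply]
    ring
  have hqi : ∀ n j l, Integrable
      (fun ω => |(gram (X n))⁻¹ j l| * ((w n j ω ^ 2 + w n l ω ^ 2) / 2)) P := fun n j l =>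
    ((((hwL n j).integrable_sq.add (hwL n l).integrable_sq).div_const 2).const_mul _ :)
  have hqs : ∀ n, Integrable (fun ω => ∑ j, ∑ l,
      |(gram (X n))⁻¹ j l| * ((w n j ω ^ 2 + w n l ω ^ 2) / 2)) P := fun n =>
    integrable_finsetSum _ fun j _ => integrable_finsetSum _ fun l _ => hqi n j l
  have hmi : ∀ n : ℕ, Integrable (fun ω => ((√(n : ℝ))⁻¹ + √(n : ℝ) * m n ω ^ 2) / 2) P := fun n =>
    (((integrable_const _).add ((hmL n).integrable_sq.const_mul _)).div_const 2 :)
  -- `|m| ≤ (n^(-1/2) + n^(1/2) m²) / 2` trades the first absolute moment for the second.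
  set g : ℕ → Ω → ℝ := fun n ω => s⁻¹ * (r n * (((√(n : ℝ))⁻¹ + √(n : ℝ) * m n ω ^ 2) / 2 +
    ∑ j, ∑ l, |(gram (X n))⁻¹ j l| * ((w n j ω ^ 2 + w n l ω ^ 2) / 2)) +
      K / (n - K) * s ^ 2) with hg
  have hw2 : ∀ᶠ n in atTop, ∀ j, ∫ ω, w n j ω ^ 2 ∂P = s ^ 2 / n := by
    filter_upwards [hX2, eventually_gt_atTop 0] with n hn hn0 j
    have hn' : (0 : ℝ) < n := by exact_mod_cast hn0
    rw [integral_sum_mul_sq (fun i => memLp_two_of_four (hε4 n i)) (hεi n) (h1 n) (h2 n)]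
    simp_rw [div_pow]
    rw [← Finset.sum_div, hn]
    field_simp
  set b : ℕ → ℝ := fun n => s⁻¹ * (r n * (((√(n : ℝ))⁻¹ + M * (√(n : ℝ))⁻¹) / 2 +
    C n * (s ^ 2 / n)) + K / (n - K) * s ^ 2) with hb
  have hnK : Tendsto (fun n : ℕ => (n : ℝ) - K) atTop atTop :=
    tendsto_atTop_add_const_right _ _ tendsto_natCast_atTop_atTop
  refine tendstoInMeasure_of_abs_sub_le (g := g) (b := b) ?_ ?_ ?_ ?_
  · exact Eventually.of_forall fun n =>
      ((((hmi n).add (hqs n)).const_mul _).add (integrable_const _)).const_mul _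
  · filter_upwards [hX, eventually_gt_atTop K, eventually_gt_atTop 0] with n hn hnK hn0 ω
    have hn' : (0 : ℝ) < n := by exact_mod_cast hn0
    have hnK' : (0 : ℝ) < n - K := sub_pos.2 (by exact_mod_cast hnK)
    set V := sigmaHatSq (X n) fun i => (X n).mulVec β i + ε n i ω with hV
    have hV0 : 0 ≤ V := div_nonneg (Finset.sum_nonneg fun i _ => sq_nonneg _) hnK'.le
    have hsq : |√V - s| ≤ s⁻¹ * |V - s ^ 2| := by
      have e1 : V - s ^ 2 = (√V - s) * (√V + s) := by
        nlinarith [Real.mul_self_sqrt hV0]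
      rw [e1, abs_mul, abs_of_pos (show 0 < √V + s by positivity), inv_mul_eq_div,
        le_div_iff₀ hs]
      exact mul_le_mul_of_nonneg_left (by linarith [Real.sqrt_nonneg V]) (abs_nonneg _)
    refine hsq.trans (mul_le_mul_of_nonneg_left ?_ (inv_nonneg.2 hs.le))
    set q := ∑ j, ∑ l, (gram (X n))⁻¹ j l * (w n j ω * w n l ω) with hq
    have e2 : V - s ^ 2 = r n * (m n ω - q) + K / (n - K) * s ^ 2 := by
      rw [hV, sigmaHatSq_eq hn0.ne' hn]
      simp only [hr, hm]
      rw [← hq]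
      field_simp
      ring
    have hmb : |m n ω| ≤ ((√(n : ℝ))⁻¹ + √(n : ℝ) * m n ω ^ 2) / 2 := by
      have hsn : 0 < √(n : ℝ) := Real.sqrt_pos.2 hn'
      rw [le_div_iff₀ two_pos, ← sq_abs (m n ω), ← sub_nonneg]
      have : (√(n : ℝ))⁻¹ + √(n : ℝ) * |m n ω| ^ 2 - |m n ω| * 2 =
          (√(n : ℝ))⁻¹ * (√(n : ℝ) * |m n ω| - 1) ^ 2 := by
        field_simp
        ring
      rw [this]
      positivity
    have hqb : |q| ≤ ∑ j, ∑ l, |(gram (X n))⁻¹ j l| * ((w n j ω ^ 2 + w n l ω ^ 2) / 2) := by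
      refine (Finset.abs_sum_le_sum_abs _ _).trans (Finset.sum_le_sum fun j _ => ?_)
      refine (Finset.abs_sum_le_sum_abs _ _).trans (Finset.sum_le_sum fun l _ => ?_)
      rw [abs_mul]
      refine mul_le_mul_of_nonneg_left ?_ (abs_nonneg _)
      rw [abs_le]
      constructor <;> nlinarith [sq_nonneg (w n j ω + w n l ω), sq_nonneg (w n j ω - w n l ω)]
    have hr0 : 0 ≤ r n := by positivity
    rw [e2]
    refine (abs_add_le _ _).trans (add_le_add ?_ (le_of_eq (abs_of_nonneg (by positivity))))
    rw [abs_mul, abs_of_nonneg hr0]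
    refine mul_le_mul_of_nonneg_left ((abs_sub _ _).trans ?_) hr0
    exact add_le_add hmb hqb
  · filter_upwards [hw2, eventually_gt_atTop K, eventually_gt_atTop 0] with n hn hnK hn0
    have hn' : (0 : ℝ) < n := by exact_mod_cast hn0
    have hnK' : (0 : ℝ) < n - K := sub_pos.2 (by exact_mod_cast hnK)
    have hr0 : 0 ≤ r n := by positivity
    have hgi : ∫ ω, g n ω ∂P = s⁻¹ * (r n * (((√(n : ℝ))⁻¹ + √(n : ℝ) * ∫ ω, m n ω ^ 2 ∂P) / 2 +
        C n * (s ^ 2 / n)) + K / (n - K) * s ^ 2) := by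
      have hi := ((hmi n).add (hqs n)).const_mul (r n)
      simp only [Pi.add_apply] at hi
      simp only [hg]
      rw [integral_const_mul, integral_add hi (integrable_const _), integral_const_mul,
        integral_add (hmi n) (hqs n),
        integral_div, integral_add (integrable_const _) ((hmL n).integrable_sq.const_mul _),
        integral_const_mul,
        integral_finsetSum _ fun j _ => integrable_finsetSum _ fun l _ => hqi n j l]
      have : ∀ j, ∫ ω, ∑ l, |(gram (X n))⁻¹ j l| * ((w n j ω ^ 2 + w n l ω ^ 2) / 2) ∂P =
          ∑ l, |(gram (X n))⁻¹ j l| * (s ^ 2 / n) := fun j => by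
        rw [integral_finsetSum _ fun l _ => hqi n j l]
        refine Finset.sum_congr rfl fun l _ => ?_
        rw [integral_const_mul, integral_div,
          integral_add (hwL n j).integrable_sq (hwL n l).integrable_sq, hn, hn]
        ring
      simp_rw [this]
      simp [hC, Finset.sum_mul]
    rw [hgi]
    have hmm : √(n : ℝ) * ∫ ω, m n ω ^ 2 ∂P ≤ M * (√(n : ℝ))⁻¹ := by
      have := integral_mean_sq_sub_sq_le hn0 (hε4 n) (hεi n) (h2 n) (hM n)
      calc √(n : ℝ) * ∫ ω, m n ω ^ 2 ∂P ≤ √(n : ℝ) * (M / n) := by gcongr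
        _ = M * (√(n : ℝ))⁻¹ := by
          rw [← Real.sqrt_div_self]
          ring
    simp only [hb]
    gcongr
  · have hCt : Tendsto C atTop (𝓝 (∑ j, ∑ l, |S₀ j l|)) := by
      refine tendsto_finsetSum _ fun j _ => tendsto_finsetSum _ fun l _ => ?_
      exact ((tendsto_pi_nhds.1 (tendsto_pi_nhds.1 hG j)) l).abs
    have hinv : Tendsto (fun n : ℕ => (√(n : ℝ))⁻¹) atTop (𝓝 0) :=
      tendsto_inv_atTop_zero.comp (Real.tendsto_sqrt_atTop.comp tendsto_natCast_atTop_atTop)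
    have hKt : Tendsto (fun n : ℕ => (K : ℝ) / (n - K)) atTop (𝓝 0) :=
      tendsto_const_nhds.div_atTop hnK
    have hrt : Tendsto r atTop (𝓝 1) := by
      have : Tendsto (fun n : ℕ => 1 + (K : ℝ) / (n - K)) atTop (𝓝 1) := by
        simpa using hKt.const_add 1
      refine this.congr' ?_
      filter_upwards [eventually_gt_atTop K] with n hn
      have hnK' : (0 : ℝ) < n - K := sub_pos.2 (by exact_mod_cast hn)
      simp only [hr]
      field_simp
      ring
    have hst : Tendsto (fun n : ℕ => s ^ 2 / (n : ℝ)) atTop (𝓝 0) :=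
      tendsto_const_nhds.div_atTop tendsto_natCast_atTop_atTop
    have := (((hrt.mul (((hinv.add (hinv.const_mul M)).div_const 2).add (hCt.mul hst))).add
      (hKt.mul_const (s ^ 2))).const_mul s⁻¹)
    simpa using this

/-! ### Standard normal quantiles -/

theorem continuous_cdf_gaussianReal : Continuous (cdf (gaussianReal 0 1)) := by
  have : NullSingletonClass (gaussianReal 0 1) := nullSingletonClass_gaussianReal one_ne_zero
  rw [continuous_iff_continuousAt]
  intro x
  have h := (cdf (gaussianReal 0 1)).measure_singleton x
  rw [measure_cdf, measure_singleton] at h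
  refine (monotone_cdf _).continuousAt_iff_leftLim_eq_rightLim.2 ?_
  rw [StieltjesFunction.rightLim_eq]
  exact le_antisymm ((monotone_cdf _).leftLim_le le_rfl)
    (by linarith [ENNReal.ofReal_eq_zero.1 h.symm])

theorem gaussianReal_real_Ici_neg (x : ℝ) :
    (gaussianReal 0 1).real (Set.Ici (-x)) = cdf (gaussianReal 0 1) x := by
  have h : (gaussianReal 0 1).map (fun y => -y) = gaussianReal 0 1 := by
    rw [gaussianReal_map_neg, neg_zero]
  rw [cdf_eq_real]
  conv_rhs => rw [← h]
  rw [map_measureReal_apply measurable_neg measurableSet_Iic]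
  congr 1
  ext y
  simp

theorem gaussianReal_real_Ici (x : ℝ) :
    (gaussianReal 0 1).real (Set.Ici x) = 1 - cdf (gaussianReal 0 1) x := by
  have : NullSingletonClass (gaussianReal 0 1) :=
    nullSingletonClass_gaussianReal one_ne_zero
  rw [← measureReal_congr (Ioi_ae_eq_Ici (a := x) (μ := gaussianReal 0 1)), cdf_eq_real,
    ← Set.compl_Iic, probReal_compl_eq_one_sub measurableSet_Iic]

theorem cdf_gaussianReal_lt_half {x : ℝ} (hx : x < 0) : cdf (gaussianReal 0 1) x < 1 / 2 := by
  have hpos : 0 < (gaussianReal 0 1).real (Set.Ioo x (-x)) := by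
    rw [measureReal_def, ENNReal.toReal_pos_iff]
    refine ⟨pos_iff_ne_zero.2 fun h => ?_, measure_lt_top _ _⟩
    have := gaussianReal_absolutelyContinuous' 0 one_ne_zero h
    rw [Real.volume_Ioo, ENNReal.ofReal_eq_zero] at this
    linarith
  have hd1 : Disjoint (Set.Iic x) (Set.Ioo x (-x)) :=
    Set.disjoint_left.2 fun y h1 h2 => (h2.1.trans_le h1).false
  have hd2 : Disjoint (Set.Iic x ∪ Set.Ioo x (-x)) (Set.Ici (-x)) := by
    refine Set.disjoint_left.2 fun y h1 h2 => ?_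
    rw [Set.mem_Ici] at h2
    rcases h1 with h1 | h1
    · rw [Set.mem_Iic] at h1
      linarith
    · exact (h1.2.trans_le h2).false
  have h1 := measureReal_le_one (μ := gaussianReal 0 1)
    (s := Set.Iic x ∪ Set.Ioo x (-x) ∪ Set.Ici (-x))
  rw [measureReal_union hd2 measurableSet_Ici, measureReal_union hd1 measurableSet_Ioo,
    gaussianReal_real_Ici_neg, ← cdf_eq_real] at h1
  linarith

theorem cdf_zUpper {p : ℝ} (hp0 : 0 < p) (hp1 : p < 1) :
    cdf (gaussianReal 0 1) (zUpper p) = 1 - p := by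
  have hcont := continuous_cdf_gaussianReal
  obtain ⟨x, hx⟩ : ∃ x, cdf (gaussianReal 0 1) x = 1 - p := by
    refine mem_range_of_exists_le_of_exists_ge hcont ?_ ?_
    · exact ((tendsto_cdf_atBot _).eventually_le_const (by linarith)).exists
    · exact ((tendsto_cdf_atTop _).eventually_const_le (by linarith)).exists
  have hne : {x : ℝ | 1 - p ≤ cdf (gaussianReal 0 1) x}.Nonempty := ⟨x, hx.ge⟩
  obtain ⟨y, hy⟩ := ((tendsto_cdf_atBot (gaussianReal 0 1)).eventually_lt_const
    (show (0 : ℝ) < 1 - p by linarith)).exists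
  have hbdd : BddBelow {x : ℝ | 1 - p ≤ cdf (gaussianReal 0 1) x} := by
    refine ⟨y, fun t ht => le_of_not_gt fun h => ?_⟩
    exact absurd (monotone_cdf (gaussianReal 0 1) h.le) (not_le.2 (hy.trans_le ht))
  have hclosed : IsClosed {x : ℝ | 1 - p ≤ cdf (gaussianReal 0 1) x} :=
    isClosed_le continuous_const hcont
  refine le_antisymm ?_ (hclosed.csInf_mem hne hbdd)
  rw [← hx]
  exact monotone_cdf _ (csInf_le hbdd hx.ge)

theorem zUpper_nonneg {p : ℝ} (hp0 : 0 < p) (hp1 : p ≤ 1 / 2) : 0 ≤ zUpper p := by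
  by_contra! h
  have := cdf_gaussianReal_lt_half h
  rw [cdf_zUpper hp0 (by linarith)] at this
  linarith

/-- The two-sided test with critical value `z_{a/2}` has level exactly `a`. -/
theorem gaussianReal_real_zUpper_le_abs {a : ℝ} (ha0 : 0 < a) (ha1 : a ≤ 1) :
    (gaussianReal 0 1).real {x | zUpper (a / 2) ≤ |x|} = a := by
  set z := zUpper (a / 2) with hz
  have hz0 : 0 ≤ z := zUpper_nonneg (by linarith) (by linarith)
  have hc : cdf (gaussianReal 0 1) z = 1 - a / 2 := cdf_zUpper (by linarith) (by linarith)
  have : NullSingletonClass (gaussianReal 0 1) :=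
    nullSingletonClass_gaussianReal one_ne_zero
  have e : {x : ℝ | z ≤ |x|} = Set.Iic (-z) ∪ Set.Ici z := by
    ext x
    simp only [Set.mem_ofPred_eq, Set.mem_union, Set.mem_Iic, Set.mem_Ici, le_abs, le_neg]
    exact or_comm
  have hcn : cdf (gaussianReal 0 1) (-z) = a / 2 := by
    have := gaussianReal_real_Ici_neg (-z)
    rw [neg_neg, gaussianReal_real_Ici, hc] at this
    linarith
  have e' : (gaussianReal 0 1).real (Set.Iic (-z) ∪ Set.Ici z) =
      (gaussianReal 0 1).real (Set.Iio (-z) ∪ Set.Ici z) :=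
    measureReal_congr (Iio_ae_eq_Iic.symm.union (ae_eq_refl _))
  rw [e, e', measureReal_union (Set.disjoint_left.2 fun x h1 h2 => ?_) measurableSet_Ici,
    measureReal_congr (Iio_ae_eq_Iic (a := -z)), gaussianReal_real_Ici, ← cdf_eq_real, hc, hcn]
  · ring
  · rw [Set.mem_Iio] at h1
    rw [Set.mem_Ici] at h2
    linarith

/-! ### Patterns of rejected tests -/

/-- The pattern of rejections of a family of two-sided tests: `1` where the statistic reaches its
critical value in absolute value and `0` elsewhere. -/
noncomputable def pattern {ι : Type*} (z x : ι → ℝ) : ι → ℕ :=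
  fun j => if z j ≤ |x j| then 1 else 0

theorem measurable_pattern {ι : Type*} (z : ι → ℝ) : Measurable (pattern z) := by
  refine measurable_pi_iff.2 fun j => Measurable.ite ?_ measurable_const measurable_const
  exact measurableSet_le measurable_const (measurable_pi_apply j).abs

theorem map_pattern_gaussian {ι : Type*} [Fintype ι] (α : ι → unitInterval)
    (hα : ∀ j, 0 < α j) :
    (Measure.pi fun _ : ι => gaussianReal 0 1).map (pattern fun j => zUpper ((α j : ℝ) / 2)) =
      Measure.pi fun j => bernoulliMeasure (1 : ℕ) 0 (α j) := by
  have hf : ∀ j, Measurable fun x : ℝ => if zUpper ((α j : ℝ) / 2) ≤ |x| then (1 : ℕ) else 0 :=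
    fun j => Measurable.ite (measurableSet_le measurable_const continuous_abs.measurable)
      measurable_const measurable_const
  have hp : ∀ j, IsProbabilityMeasure ((gaussianReal 0 1).map
      fun x : ℝ => if zUpper ((α j : ℝ) / 2) ≤ |x| then (1 : ℕ) else 0) := fun j =>
    Measure.isProbabilityMeasure_map (hf j).aemeasurable
  have h := Measure.pi_map_pi (μ := fun _ : ι => gaussianReal 0 1)
    (f := fun j x => if zUpper ((α j : ℝ) / 2) ≤ |x| then (1 : ℕ) else 0)
    (fun j => (hf j).aemeasurable)
  refine h.trans ?_
  congr 1
  funext j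
  have hlev := gaussianReal_real_zUpper_le_abs (a := α j) (hα j) (α j).2.2
  have hms : MeasurableSet {x : ℝ | zUpper ((α j : ℝ) / 2) ≤ |x|} :=
    measurableSet_le measurable_const continuous_abs.measurable
  have hlev' : (gaussianReal 0 1).real {x | ¬ zUpper ((α j : ℝ) / 2) ≤ |x|} = 1 - α j := by
    have h := probReal_compl_eq_one_sub (μ := gaussianReal 0 1) hms
    rwa [hlev] at h
  refine Measure.ext_of_singleton fun k => ?_
  rw [← ENNReal.toReal_eq_toReal_iff' (measure_ne_top _ _) (measure_ne_top _ _)]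
  change Measure.real _ _ = Measure.real _ _
  rw [map_measureReal_apply (hf j) (measurableSet_singleton k)]
  rcases k with _ | _ | k
  · rw [bernoulliMeasure_real_apply _ (measurableSet_singleton _)]
    simpa [Set.preimage] using hlev'
  · rw [bernoulliMeasure_real_apply _ (measurableSet_singleton _)]
    simpa [Set.preimage] using hlev
  · rw [bernoulliMeasure_real_apply _ (measurableSet_singleton _)]
    have : (fun x : ℝ => if zUpper ((α j : ℝ) / 2) ≤ |x| then (1 : ℕ) else 0) ⁻¹' {k + 1 + 1}
        = ∅ := by
      ext x
      refine iff_of_false (fun h => ?_) (Set.notMem_empty _)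
      have h' : (if zUpper ((α j : ℝ) / 2) ≤ |x| then (1 : ℕ) else 0) = k + 1 + 1 := h
      split_ifs at h'; omega
    rw [this]
    simp

/-- Rejection patterns of asymptotically independent standard normal statistics converge setwise:
the limiting law does not charge the boundary between acceptance and rejection. The studentization
by `S` enters through `z_j S ≤ |U_j|`, which is continuous in `(U, S)`. -/
theorem tendsto_measureReal_pattern_mem {Ω : Type*} [MeasurableSpace Ω] {P : Measure Ω}
    [IsProbabilityMeasure P] {ι : Type*} [Fintype ι] {U : ℕ → Ω → ι → ℝ} {S : ℕ → Ω → ℝ} {s : ℝ}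
    (hs : 0 < s) (hU : TendstoInDistribution U atTop (fun (x : ι → ℝ) j => s * x j) (fun _ => P)
      (Measure.pi fun _ => gaussianReal 0 1))
    (hSm : ∀ n, Measurable (S n)) (hS : TendstoInMeasure P S atTop fun _ => s)
    (z : ι → ℝ) (B : Set (ι → ℕ)) :
    Tendsto (fun n => P.real {ω | pattern (fun j => z j * S n ω) (U n ω) ∈ B}) atTop
      (𝓝 ((Measure.pi fun _ : ι => gaussianReal 0 1).real {x | pattern z x ∈ B})) := by
  have hg : Continuous fun q : (ι → ℝ) × ℝ => fun j => |q.1 j| - z j * q.2 := by fun_prop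
  have hW := hU.continuous_comp_prodMk_of_tendstoInMeasure_const hg hS
    (fun n => (hSm n).aemeasurable)
  have hna : NullSingletonClass (gaussianReal 0 1) :=
    nullSingletonClass_gaussianReal one_ne_zero
  set E : Set (ι → ℝ) := {w | (fun j => if 0 ≤ w j then (1 : ℕ) else 0) ∈ B} with hE
  have hdm : Measurable fun w : ι → ℝ => fun j => if 0 ≤ w j then (1 : ℕ) else 0 :=
    measurable_pi_iff.2 fun j => Measurable.ite
      (measurableSet_le measurable_const (measurable_pi_apply j)) measurable_const
        measurable_const
  have hEm : MeasurableSet E := hdm (Set.to_countable B).measurableSet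
  have hfr : frontier E ⊆ ⋃ j, {w | w j = 0} := by
    intro w hw
    by_contra hcon
    simp only [Set.mem_iUnion, Set.mem_ofPred_eq, not_exists] at hcon
    have hloc : ∀ᶠ v in 𝓝 w, (v ∈ E ↔ w ∈ E) := by
      have : ∀ j, ∀ᶠ v : ι → ℝ in 𝓝 w, (0 ≤ v j ↔ 0 ≤ w j) := fun j => by
        have hc := (continuous_apply j).tendsto w
        rcases lt_or_gt_of_ne (hcon j) with h | h
        · filter_upwards [hc.eventually_lt_const h] with v hv
          exact ⟨fun h' => absurd hv (not_lt.2 h'), fun h' => absurd h (not_lt.2 h')⟩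
        · filter_upwards [hc.eventually_const_lt h] with v hv
          exact ⟨fun _ => h.le, fun _ => hv.le⟩
      filter_upwards [eventually_all.2 this] with v hv
      simp only [hE, Set.mem_ofPred_eq, hv]
    rw [frontier_eq_closure_inter_closure] at hw
    have h1 := mem_closure_iff_frequently.1 hw.1
    have h2 := mem_closure_iff_frequently.1 hw.2
    obtain ⟨v, hv1, hv2⟩ := (h1.and_eventually hloc).exists
    obtain ⟨v', hv1', hv2'⟩ := (h2.and_eventually hloc).exists
    exact hv1' (hv2'.2 (hv2.1 hv1))
  have hlim : Measurable fun (x : ι → ℝ) => fun j => |s * x j| - z j * s := by fun_prop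
  have hnull : ((Measure.pi fun _ : ι => gaussianReal 0 1).map
      fun (x : ι → ℝ) j => |s * x j| - z j * s) (frontier E) = 0 := by
    refine measure_mono_null hfr (measure_iUnion_null fun j => ?_)
    rw [Measure.map_apply hlim (measurableSet_eq_fun (measurable_pi_apply j) measurable_const)]
    refine measure_mono_null (t := {x | x j = z j} ∪ {x | x j = -z j}) (fun x hx => ?_)
      (measure_union_null (Measure.pi_hyperplane _ _ _) (Measure.pi_hyperplane _ _ _))
    simp only [Set.mem_preimage, Set.mem_ofPred_eq] at hx
    rw [abs_mul, abs_of_pos hs] at hx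
    have : |x j| = z j := by
      have h3 : s * (|x j| - z j) = 0 := by linarith
      linarith [(mul_eq_zero.1 h3).resolve_left hs.ne']
    rcases abs_choice (x j) with h | h
    · exact Or.inl (by simp only [Set.mem_ofPred_eq]; linarith)
    · exact Or.inr (by simp only [Set.mem_ofPred_eq]; linarith)
  have hmain := ProbabilityMeasure.tendsto_measure_of_null_frontier_of_tendsto' hW.tendsto
    (E := E) hnull
  have h1 : ∀ n, (P.map fun ω j => |U n ω j| - z j * S n ω) E =
      P {ω | pattern (fun j => z j * S n ω) (U n ω) ∈ B} := fun n => by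
    rw [Measure.map_apply_of_aemeasurable (hW.forall_aemeasurable n) hEm]
    congr 1
    ext ω
    simp only [hE, Set.mem_preimage, Set.mem_ofPred_eq, sub_nonneg]
    rfl
  have h2 : ((Measure.pi fun _ : ι => gaussianReal 0 1).map
      fun (x : ι → ℝ) j => |s * x j| - z j * s) E =
      (Measure.pi fun _ : ι => gaussianReal 0 1) {x | pattern z x ∈ B} := by
    rw [Measure.map_apply hlim hEm]
    congr 1
    ext x
    have : ∀ j, (0 ≤ |s * x j| - z j * s ↔ z j ≤ |x j|) := fun j => by
      rw [abs_mul, abs_of_pos hs, sub_nonneg, mul_comm (z j), mul_le_mul_iff_right₀ hs]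
    simp only [hE, Set.mem_preimage, Set.mem_ofPred_eq, this]
    rfl
  have hmain' : Tendsto (fun n => P {ω | pattern (fun j => z j * S n ω) (U n ω) ∈ B}) atTop
      (𝓝 ((Measure.pi fun _ : ι => gaussianReal 0 1) {x | pattern z x ∈ B})) := by
    rw [← h2]
    simp_rw [← h1]
    exact hmain
  exact (ENNReal.tendsto_toReal (measure_ne_top _ _)).comp hmain'

/-! ### Limits of events and of bounded integer-valued statistics -/

section Events

variable {Ω : Type*} [MeasurableSpace Ω] {P : Measure Ω} [IsProbabilityMeasure P]

/-- Events that agree on sets of probability tending to one have the same limiting probability. -/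
theorem tendsto_measureReal_of_iff_on {A B G : ℕ → Set Ω} {c : ℝ}
    (h : ∀ᶠ n in atTop, ∀ ω ∈ G n, (ω ∈ A n ↔ ω ∈ B n))
    (hG : Tendsto (fun n => P.real (G n)ᶜ) atTop (𝓝 0))
    (hA : Tendsto (fun n => P.real (A n)) atTop (𝓝 c)) :
    Tendsto (fun n => P.real (B n)) atTop (𝓝 c) := by
  have h1 : Tendsto (fun n => P.real (A n) - P.real (G n)ᶜ) atTop (𝓝 c) := by
    simpa using hA.sub hG
  have h2 : Tendsto (fun n => P.real (A n) + P.real (G n)ᶜ) atTop (𝓝 c) := by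
    simpa using hA.add hG
  refine tendsto_of_tendsto_of_tendsto_of_le_of_le' h1 h2 ?_ ?_
  · filter_upwards [h] with n hn
    have : P.real (A n) ≤ P.real (B n ∪ (G n)ᶜ) := measureReal_mono fun ω hω => by
      by_cases hg : ω ∈ G n
      · exact Or.inl ((hn ω hg).1 hω)
      · exact Or.inr hg
    linarith [measureReal_union_le (μ := P) (B n) (G n)ᶜ]
  · filter_upwards [h] with n hn
    have : P.real (B n) ≤ P.real (A n ∪ (G n)ᶜ) := measureReal_mono fun ω hω => by
      by_cases hg : ω ∈ G n
      · exact Or.inl ((hn ω hg).2 hω)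
      · exact Or.inr hg
    linarith [measureReal_union_le (μ := P) (A n) (G n)ᶜ]

theorem tendsto_measureReal_nonpos {S : ℕ → Ω → ℝ} {s : ℝ} (hs : 0 < s)
    (hS : TendstoInMeasure P S atTop fun _ => s) :
    Tendsto (fun n => P.real {ω | S n ω ≤ 0}) atTop (𝓝 0) := by
  refine squeeze_zero (fun _ => measureReal_nonneg) (fun n => ?_)
    (tendstoInMeasure_iff_measureReal_norm.1 hS s hs)
  refine measureReal_mono fun ω (hω : S n ω ≤ 0) => ?_
  simp only [Set.mem_ofPred_eq, Real.norm_eq_abs]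
  rw [abs_sub_comm]
  exact (by linarith : s ≤ s - S n ω).trans (le_abs_self _)

/-- A test whose noncentrality `m` diverges rejects with probability tending to one. -/
theorem tendsto_measureReal_accept {S N : ℕ → Ω → ℝ} {m : ℕ → ℝ} {s v z : ℝ} (hs : 0 < s)
    (hS : TendstoInMeasure P S atTop fun _ => s) (hz : 0 ≤ z)
    (hm : Tendsto (fun n => |m n|) atTop atTop) (hN : ∀ n, MemLp (N n) 2 P)
    (hN0 : ∀ᶠ n in atTop, ∫ ω, N n ω ^ 2 ∂P = v) :
    Tendsto (fun n => P.real {ω | |m n + N n ω| < z * S n ω}) atTop (𝓝 0) := by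
  have h1 := tendstoInMeasure_iff_measureReal_norm.1 hS s hs
  have h2 : Tendsto (fun n => v / (|m n| - z * (2 * s)) ^ 2) atTop (𝓝 0) := by
    refine tendsto_const_nhds.div_atTop ?_
    exact (tendsto_pow_atTop two_ne_zero).comp
      (tendsto_atTop_add_const_right _ (-(z * (2 * s))) hm)
  refine squeeze_zero' (Eventually.of_forall fun _ => measureReal_nonneg) ?_
    (by simpa using h1.add h2)
  filter_upwards [hN0, hm.eventually_gt_atTop (z * (2 * s))] with n hn hmn
  set d := |m n| - z * (2 * s) with hd
  have hd0 : 0 < d := sub_pos.2 hmn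
  have hcheb : P.real {ω | d ^ 2 ≤ N n ω ^ 2} ≤ v / d ^ 2 := by
    rw [le_div_iff₀ (by positivity), mul_comm, ← hn]
    exact mul_meas_ge_le_integral_of_nonneg (ae_of_all _ fun ω => sq_nonneg _)
      (hN n).integrable_sq _
  refine le_trans (measureReal_mono fun ω hω => ?_)
    ((measureReal_union_le _ _).trans (add_le_add le_rfl hcheb))
  by_cases hc : s ≤ ‖S n ω - s‖
  · exact Or.inl hc
  · right
    rw [Real.norm_eq_abs, not_le, abs_lt] at hc
    simp only [Set.mem_ofPred_eq] at hω ⊢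
    have h3 : z * S n ω ≤ z * (2 * s) := mul_le_mul_of_nonneg_left (by linarith) hz
    have h4 : |m n| ≤ |m n + N n ω| + |N n ω| := by
      have := abs_sub (m n + N n ω) (N n ω)
      rwa [add_sub_cancel_right] at this
    rw [← sq_abs (N n ω)]
    exact pow_le_pow_left₀ hd0.le (by linarith) 2

/-- Integer-valued statistics bounded by `K` converge in distribution as soon as their point
probabilities converge; the limiting weights then sum to one automatically. -/
theorem exists_tendstoInDistribution_nat {T : ℕ → Ω → ℕ} (hT : ∀ n, Measurable (T n)) {K : ℕ}
    (hTK : ∀ n ω, T n ω ≤ K) {p : ℕ → ℝ}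
    (hp : ∀ k ≤ K, Tendsto (fun n => P.real {ω | T n ω = k}) atTop (𝓝 (p k))) :
    ∃ μ : ProbabilityMeasure ℕ,
      TendstoInDistribution T atTop (id : ℕ → ℕ) (fun _ => P) (μ : Measure ℕ) ∧
      ∀ k ≤ K, (μ : Measure ℕ).real {k} = p k := by
  have hmap : ∀ n k, (P.map (T n)).real {k} = P.real {ω | T n ω = k} := fun n k => by
    rw [map_measureReal_apply (hT n) (measurableSet_singleton k)]
    rfl
  have hprob : ∀ n, IsProbabilityMeasure (P.map (T n)) := fun n =>
    Measure.isProbabilityMeasure_map (hT n).aemeasurable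
  have hint : ∀ (ν : Measure ℕ) [IsProbabilityMeasure ν], ν (Finset.range (K + 1) : Set ℕ)ᶜ = 0 →
      ∀ f : BoundedContinuousFunction ℕ ℝ,
        ∫ x, f x ∂ν = ∑ k ∈ Finset.range (K + 1), ν.real {k} * f k := by
    intro ν _ hν f
    have hr : ν.restrict (Finset.range (K + 1) : Set ℕ) = ν :=
      Measure.restrict_eq_self_of_ae_mem (by rwa [ae_iff])
    rw [← hr, setIntegral_finset _ (f.integrable ν).integrableOn, hr]
    simp
  have hTc : ∀ n, (P.map (T n)) (Finset.range (K + 1) : Set ℕ)ᶜ = 0 := fun n => by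
    rw [Measure.map_apply (hT n) (Finset.measurableSet _).compl]
    convert measure_empty (μ := P)
    ext ω
    simpa using Nat.lt_succ_of_le (hTK n ω)
  have hp0 : ∀ k ∈ Finset.range (K + 1), 0 ≤ p k := fun k hk =>
    ge_of_tendsto' (hp k (Nat.lt_succ_iff.1 (Finset.mem_range.1 hk))) fun _ => measureReal_nonneg
  have hsum : ∑ k ∈ Finset.range (K + 1), p k = 1 := by
    have h1 : Tendsto (fun n => ∑ k ∈ Finset.range (K + 1), (P.map (T n)).real {k}) atTop
        (𝓝 (∑ k ∈ Finset.range (K + 1), p k)) := by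
      simp_rw [hmap]
      exact tendsto_finsetSum _ fun k hk => hp k (Nat.lt_succ_iff.1 (Finset.mem_range.1 hk))
    have h2 : ∀ n, ∑ k ∈ Finset.range (K + 1), (P.map (T n)).real {k} = 1 := fun n => by
      have := hint (P.map (T n)) (hTc n) 1
      simpa using this.symm
    simp_rw [h2] at h1
    exact tendsto_nhds_unique h1 tendsto_const_nhds
  set μ : Measure ℕ :=
    ∑ k ∈ Finset.range (K + 1), ENNReal.ofReal (p k) • Measure.dirac k with hμ
  have hμu : IsProbabilityMeasure μ := ⟨by
    simp only [hμ, Measure.finsetSum_apply, Measure.smul_apply, measure_univ, smul_eq_mul, mul_one]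
    rw [← ENNReal.ofReal_sum_of_nonneg hp0, hsum, ENNReal.ofReal_one]⟩
  have hμk : ∀ k ≤ K, μ.real {k} = p k := fun k hk => by
    have hk' : k ∈ Finset.range (K + 1) := Finset.mem_range.2 (Nat.lt_succ_of_le hk)
    rw [measureReal_def, hμ, Measure.finsetSum_apply, Finset.sum_eq_single_of_mem k hk'
      fun j _ hj => by simp [hj]]
    simp [ENNReal.toReal_ofReal (hp0 k hk')]
  have hμc : μ (Finset.range (K + 1) : Set ℕ)ᶜ = 0 := by
    rw [hμ, Measure.finsetSum_apply]
    refine Finset.sum_eq_zero fun k hk => ?_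
    have : k < K + 1 := Finset.mem_range.1 hk
    simp [Nat.lt_succ_iff.1 this]
  let ν : ProbabilityMeasure ℕ := ⟨μ, hμu⟩
  refine ⟨ν, ⟨fun n => (hT n).aemeasurable, aemeasurable_id, ?_⟩, hμk⟩
  refine ProbabilityMeasure.tendsto_iff_forall_integral_tendsto.2 fun f => ?_
  change Tendsto (fun n => ∫ x, f x ∂(P.map (T n))) atTop (𝓝 (∫ x, f x ∂(μ.map id)))
  rw [Measure.map_id, hint μ hμc]
  have h3 : ∀ n, ∫ x, f x ∂(P.map (T n)) =
      ∑ k ∈ Finset.range (K + 1), (P.map (T n)).real {k} * f k := fun n => hint _ (hTc n) f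
  simp_rw [h3, hmap]
  refine tendsto_finsetSum _ fun k hk => ?_
  have hk' : k ≤ K := Nat.lt_succ_iff.1 (Finset.mem_range.1 hk)
  rw [hμk k hk']
  exact (hp k hk').mul_const _

end Events

/-! ### Test statistics as inner products with unit vectors -/

section TestDirections

open Matrix

variable {n K p : ℕ}

/-- The vector `u` for which `√n β̂_l / s_{ll}^{1/2} = ⟨u, Y⟩` in the regression on the columns
of `A`: the part of the `l`-th column orthogonal to the other columns, scaled to unit length. -/
noncomputable def testDir (A : Matrix (Fin n) (Fin p) ℝ) (l : Fin p) : Fin n → ℝ :=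
  fun r => √(n : ℝ) / √((gram A)⁻¹ l l) * (A * (Aᵀ * A)⁻¹) r l

theorem sqrt_mul_ols_div (A : Matrix (Fin n) (Fin p) ℝ) (Y : Fin n → ℝ) (l : Fin p) :
    √(n : ℝ) * ols A Y l / √((gram A)⁻¹ l l) = ∑ r, testDir A l r * Y r := by
  have h1 : (A * (Aᵀ * A)⁻¹)ᵀ = (Aᵀ * A)⁻¹ * Aᵀ := by
    rw [transpose_mul, transpose_nonsing_inv, transpose_mul, transpose_transpose]
  have h2 : ols A Y l = ∑ r, (A * (Aᵀ * A)⁻¹) r l * Y r := by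
    rw [ols, mulVec_mulVec, ← h1]
    rfl
  rw [h2, Finset.mul_sum, Finset.sum_div]
  refine Finset.sum_congr rfl fun r _ => ?_
  rw [testDir]
  ring

/-- The direction of the `l`-th test is orthogonal to all other columns. -/
theorem sum_mul_testDir {A : Matrix (Fin n) (Fin p) ℝ} (hA : (Aᵀ * A).PosDef) (j l : Fin p) :
    ∑ r, A r j * testDir A l r = if j = l then √(n : ℝ) / √((gram A)⁻¹ l l) else 0 := by
  have hdet : IsUnit (Aᵀ * A).det := (Matrix.isUnit_iff_isUnit_det _).1 hA.isUnit
  have h1 : (Aᵀ * (A * (Aᵀ * A)⁻¹)) j l = (1 : Matrix (Fin p) (Fin p) ℝ) j l := by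
    rw [← Matrix.mul_assoc, mul_nonsing_inv _ hdet]
  rw [mul_apply, one_apply] at h1
  calc ∑ r, A r j * testDir A l r
      = √(n : ℝ) / √((gram A)⁻¹ l l) * ∑ r, Aᵀ j r * (A * (Aᵀ * A)⁻¹) r l := by
        rw [Finset.mul_sum]
        refine Finset.sum_congr rfl fun r _ => ?_
        rw [testDir, transpose_apply]
        ring
    _ = _ := by rw [h1, mul_ite, mul_one, mul_zero]

theorem posDef_gram (hn : 0 < n) {A : Matrix (Fin n) (Fin p) ℝ} (hA : (Aᵀ * A).PosDef) :
    (gram A).PosDef :=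
  hA.smul (inv_pos.2 (by exact_mod_cast hn : (0 : ℝ) < n))

theorem testDir_eq_sum (hn : 0 < n) {A : Matrix (Fin n) (Fin p) ℝ} (hA : (Aᵀ * A).PosDef)
    (l : Fin p) (r : Fin n) :
    testDir A l r = ∑ j, (√(n : ℝ))⁻¹ * ((gram A)⁻¹ j l / √((gram A)⁻¹ l l)) * A r j := by
  have hn' : (0 : ℝ) < n := by exact_mod_cast hn
  rw [testDir, inv_transpose_mul_self hn.ne' hA, mul_apply, Finset.mul_sum]
  refine Finset.sum_congr rfl fun j _ => ?_
  rw [Matrix.smul_apply, smul_eq_mul]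
  have h : √(n : ℝ) * (n : ℝ)⁻¹ = (√(n : ℝ))⁻¹ := by
    rw [← div_eq_mul_inv, Real.sqrt_div_self]
  rw [← h]
  ring

theorem sum_testDir_sq (hn : 0 < n) {A : Matrix (Fin n) (Fin p) ℝ} (hA : (Aᵀ * A).PosDef)
    (l : Fin p) : ∑ r, testDir A l r * testDir A l r = 1 := by
  have hn' : (0 : ℝ) < n := by exact_mod_cast hn
  have hs : 0 < (gram A)⁻¹ l l := (posDef_gram hn hA).inv.diag_pos
  calc ∑ r, testDir A l r * testDir A l r
      = ∑ r, ∑ j, (√(n : ℝ))⁻¹ * ((gram A)⁻¹ j l / √((gram A)⁻¹ l l)) *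
          (A r j * testDir A l r) := by
        refine Finset.sum_congr rfl fun r _ => ?_
        conv_lhs => rw [testDir_eq_sum hn hA, Finset.sum_mul, ← testDir_eq_sum hn hA]
        exact Finset.sum_congr rfl fun j _ => by ring
    _ = ∑ j, (√(n : ℝ))⁻¹ * ((gram A)⁻¹ j l / √((gram A)⁻¹ l l)) *
          ∑ r, A r j * testDir A l r := by
        rw [Finset.sum_comm]
        simp_rw [Finset.mul_sum]
    _ = (√(n : ℝ))⁻¹ * ((gram A)⁻¹ l l / √((gram A)⁻¹ l l)) *
          (√(n : ℝ) / √((gram A)⁻¹ l l)) := by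
        simp_rw [sum_mul_testDir hA]
        simp
    _ = 1 := by
        have h1 : √((gram A)⁻¹ l l) ≠ 0 := (Real.sqrt_pos.2 hs).ne'
        have h2 : √(n : ℝ) ≠ 0 := (Real.sqrt_pos.2 hn').ne'
        rw [Real.div_sqrt]
        field_simp

theorem abs_testDir_le (hn : 0 < n) {A : Matrix (Fin n) (Fin p) ℝ} (hA : (Aᵀ * A).PosDef)
    (l : Fin p) (r : Fin n) {a : ℝ} (ha : ∀ j, |A r j| ≤ a) :
    |testDir A l r| ≤ a / √(n : ℝ) * ∑ j, |(gram A)⁻¹ j l / √((gram A)⁻¹ l l)| := by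
  rw [testDir_eq_sum hn hA, Finset.mul_sum]
  refine (Finset.abs_sum_le_sum_abs _ _).trans (Finset.sum_le_sum fun j _ => ?_)
  rw [abs_mul, abs_mul, abs_of_nonneg (by positivity : 0 ≤ (√(n : ℝ))⁻¹)]
  have : 0 ≤ (√(n : ℝ))⁻¹ * |(gram A)⁻¹ j l / √((gram A)⁻¹ l l)| := by positivity
  calc _ ≤ (√(n : ℝ))⁻¹ * |(gram A)⁻¹ j l / √((gram A)⁻¹ l l)| * a :=
        mul_le_mul_of_nonneg_left (ha j) this
    _ = _ := by ring

theorem testDir_of_gram_eq_one (hn : 0 < n) {A : Matrix (Fin n) (Fin p) ℝ} (hA : gram A = 1)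
    (l : Fin p) (r : Fin n) : testDir A l r = A r l / √(n : ℝ) := by
  have hn' : (n : ℝ) ≠ 0 := by exact_mod_cast hn.ne'
  have h1 : Aᵀ * A = (n : ℝ) • (1 : Matrix (Fin p) (Fin p) ℝ) := by
    rw [← hA, gram, smul_smul, mul_inv_cancel₀ hn', one_smul]
  have hpd : (Aᵀ * A).PosDef := by
    rw [h1]
    exact Matrix.PosDef.one.smul (by exact_mod_cast hn : (0 : ℝ) < n)
  rw [testDir_eq_sum hn hpd, hA, inv_one, Finset.sum_eq_single l]
  · simp
    ring
  · intro j _ hj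
    simp [one_apply_ne hj]
  · simp

/-! ### The directions of the stepwise tests -/

/-- The unit vector of the `i`-th stepwise test: the normalized component of column `i` orthogonal
to the preceding columns. -/
noncomputable def stepDir (X : Matrix (Fin n) (Fin K) ℝ) (i : Fin K) : Fin n → ℝ :=
  testDir (firstCols X (i + 1) i.isLt) (Fin.last i)

/-- The diagonal entry `s_{kk}[k]`, `k = i + 1`, that standardizes the `i`-th stepwise test. -/
noncomputable def stepVar (X : Matrix (Fin n) (Fin K) ℝ) (i : Fin K) : ℝ :=
  (gram (firstCols X (i + 1) i.isLt))⁻¹ (Fin.last i) (Fin.last i)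

theorem gram_firstCols (X : Matrix (Fin n) (Fin K) ℝ) (k : ℕ) (hk : k ≤ K) :
    gram (firstCols X k hk) = (gram X).submatrix (Fin.castLE hk) (Fin.castLE hk) := rfl

theorem posDef_firstCols {X : Matrix (Fin n) (Fin K) ℝ} (hX : (Xᵀ * X).PosDef) (k : ℕ)
    (hk : k ≤ K) : ((firstCols X k hk)ᵀ * firstCols X k hk).PosDef :=
  hX.submatrix (Fin.castLE_injective hk)

theorem zTilde_eq (X : Matrix (Fin n) (Fin K) ℝ) (Y : Fin n → ℝ) (i : Fin K) :
    zTilde X Y i = (∑ r, stepDir X i r * Y r) / √(sigmaHatSq X Y) := by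
  rw [stepDir, ← sqrt_mul_ols_div, zTilde, div_div, mul_comm (√(sigmaHatSq X Y))]

theorem zHat_eq (X : Matrix (Fin n) (Fin K) ℝ) (Y : Fin n → ℝ) (i : Fin K) :
    zHat X Y i = (∑ r, testDir X i r * Y r) / √(sigmaHatSq X Y) := by
  rw [← sqrt_mul_ols_div, zHat, div_div, mul_comm (√(sigmaHatSq X Y))]

theorem gram_firstCols_eq_one {X : Matrix (Fin n) (Fin K) ℝ} (hX : gram X = 1) (k : ℕ)
    (hk : k ≤ K) : gram (firstCols X k hk) = 1 := by
  rw [gram_firstCols, hX, submatrix_one _ (Fin.castLE_injective hk)]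

theorem stepDir_of_gram_eq_one (hn : 0 < n) {X : Matrix (Fin n) (Fin K) ℝ} (hX : gram X = 1)
    (i : Fin K) : stepDir X i = testDir X i := by
  funext r
  rw [stepDir, testDir_of_gram_eq_one hn (gram_firstCols_eq_one hX _ _),
    testDir_of_gram_eq_one hn hX]
  rfl

/-- For an orthogonal design, the later columns do not change the earlier coefficients. -/
theorem zTilde_eq_zHat (hn : 0 < n) {X : Matrix (Fin n) (Fin K) ℝ} (hX : gram X = 1)
    (Y : Fin n → ℝ) (i : Fin K) : zTilde X Y i = zHat X Y i := by
  rw [zTilde_eq, zHat_eq, stepDir_of_gram_eq_one hn hX]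

theorem sum_mul_stepDir {X : Matrix (Fin n) (Fin K) ℝ} (hX : (Xᵀ * X).PosDef) {i j : Fin K}
    (hji : j ≤ i) :
    ∑ r, X r j * stepDir X i r = if j = i then √(n : ℝ) / √(stepVar X i) else 0 := by
  have hlt : (j : ℕ) < i + 1 := Nat.lt_succ_of_le hji
  have h := sum_mul_testDir (posDef_firstCols hX (i + 1) i.isLt) ⟨j, hlt⟩ (Fin.last i)
  have e : ((⟨j, hlt⟩ : Fin (i + 1)) = Fin.last i) ↔ j = i := by
    rw [Fin.ext_iff, Fin.ext_iff]
    rfl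
  simp only [e] at h
  exact h

theorem sum_stepDir_mul_stepDir (hn : 0 < n) {X : Matrix (Fin n) (Fin K) ℝ}
    (hX : (Xᵀ * X).PosDef) (i j : Fin K) :
    ∑ r, stepDir X i r * stepDir X j r = if i = j then 1 else 0 := by
  wlog hij : i ≤ j generalizing i j
  · simp_rw [mul_comm (stepDir X i _), this j i (le_of_not_ge hij), eq_comm]
  rcases hij.eq_or_lt with rfl | hlt
  · rw [if_pos rfl]
    exact sum_testDir_sq hn (posDef_firstCols hX _ _) _
  · rw [if_neg hlt.ne]
    set A := firstCols X (i + 1) i.isLt with hA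
    calc ∑ r, stepDir X i r * stepDir X j r
        = ∑ r, ∑ l, (√(n : ℝ))⁻¹ * ((gram A)⁻¹ l (Fin.last i) /
            √((gram A)⁻¹ (Fin.last i) (Fin.last i))) *
              (X r (Fin.castLE i.isLt l) * stepDir X j r) := by
          refine Finset.sum_congr rfl fun r _ => ?_
          have h := testDir_eq_sum hn (posDef_firstCols hX (i + 1) i.isLt) (Fin.last i) r
          rw [stepDir, h, Finset.sum_mul]
          exact Finset.sum_congr rfl fun l _ => by
            rw [mul_assoc]
            rfl
      _ = ∑ l, (√(n : ℝ))⁻¹ * ((gram A)⁻¹ l (Fin.last i) /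
            √((gram A)⁻¹ (Fin.last i) (Fin.last i))) *
              ∑ r, X r (Fin.castLE i.isLt l) * stepDir X j r := by
          rw [Finset.sum_comm]
          simp_rw [Finset.mul_sum]
      _ = 0 := by
          refine Finset.sum_eq_zero fun l _ => ?_
          have hl : Fin.castLE i.isLt l < j := by
            have h1 : (l : ℕ) < i + 1 := l.2
            have h2 : (i : ℕ) < j := hlt
            exact Fin.lt_def.2 (by simp only [Fin.val_castLE]; omega)
          rw [sum_mul_stepDir hX hl.le, if_neg hl.ne, mul_zero]

/-- The mean of the `i`-th stepwise statistic only involves the coefficient `i`, either because the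
later coefficients vanish or because the design is orthogonal. -/
theorem sum_stepDir_mul_mulVec (hn : 0 < n) {X : Matrix (Fin n) (Fin K) ℝ}
    (hX : (Xᵀ * X).PosDef) {β : Fin K → ℝ} {i : Fin K}
    (h : (∀ j, i < j → β j = 0) ∨ gram X = 1) :
    ∑ r, stepDir X i r * X.mulVec β r = β i * (√(n : ℝ) / √(stepVar X i)) := by
  have h1 : ∑ r, stepDir X i r * X.mulVec β r = ∑ j, β j * ∑ r, X r j * stepDir X i r := by
    simp only [mulVec, dotProduct, Finset.mul_sum]
    rw [Finset.sum_comm]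
    exact Finset.sum_congr rfl fun j _ => Finset.sum_congr rfl fun r _ => by ring
  rw [h1, Finset.sum_eq_single i]
  · rw [sum_mul_stepDir hX le_rfl, if_pos rfl]
  · intro j _ hj
    rcases lt_or_gt_of_ne hj with hlt | hlt
    · rw [sum_mul_stepDir hX hlt.le, if_neg hj, mul_zero]
    · rcases h with h | h
      · rw [h j hlt, zero_mul]
      · rw [stepDir_of_gram_eq_one hn h, sum_mul_testDir hX, if_neg hj, mul_zero]
  · simp

/-! ### Asymptotics of the designs -/

theorem tendsto_inv_of_posDef {G : ℕ → Matrix (Fin p) (Fin p) ℝ} {H : Matrix (Fin p) (Fin p) ℝ}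
    (hH : H.PosDef) (hG : Tendsto G atTop (𝓝 H)) :
    Tendsto (fun n => (G n)⁻¹) atTop (𝓝 H⁻¹) := by
  have hdet : H.det ≠ 0 := ((Matrix.isUnit_iff_isUnit_det _).1 hH.isUnit).ne_zero
  simp only [inv_def, Ring.inverse_eq_inv']
  have h1 : Tendsto (fun n => (G n).det) atTop (𝓝 H.det) :=
    ((continuous_id.matrix_det).tendsto H).comp hG
  have h2 : Tendsto (fun n => (G n).adjugate) atTop (𝓝 H.adjugate) :=
    ((continuous_id.matrix_adjugate).tendsto H).comp hG
  exact (h1.inv₀ hdet).smul h2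

section Design

variable {X : (n : ℕ) → Matrix (Fin n) (Fin K) ℝ} {S₀ : Matrix (Fin K) (Fin K) ℝ}

theorem tendsto_inv_gram_firstCols (hX : Tendsto (fun n => gram (X n)) atTop (𝓝 S₀))
    (hS₀ : S₀.PosDef) (k : ℕ) (hk : k ≤ K) :
    Tendsto (fun n => (gram (firstCols (X n) k hk))⁻¹) atTop
      (𝓝 (S₀.submatrix (Fin.castLE hk) (Fin.castLE hk))⁻¹) :=
  tendsto_inv_of_posDef (hS₀.submatrix (Fin.castLE_injective hk))
    (((continuous_id.matrix_submatrix _ _).tendsto S₀).comp hX)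

theorem tendsto_stepVar (hX : Tendsto (fun n => gram (X n)) atTop (𝓝 S₀)) (hS₀ : S₀.PosDef)
    (i : Fin K) : ∃ v : ℝ, 0 < v ∧ Tendsto (fun n => stepVar (X n) i) atTop (𝓝 v) :=
  ⟨_, (hS₀.submatrix (Fin.castLE_injective i.isLt)).inv.diag_pos,
    tendsto_pi_nhds.1 (tendsto_pi_nhds.1
      (tendsto_inv_gram_firstCols hX hS₀ (i + 1) i.isLt) (Fin.last i)) (Fin.last i)⟩

/-- The noncentrality of the test of a fixed nonzero coefficient grows like `√n`. -/
theorem tendsto_sqrt_div_sqrt_stepVar (hX : Tendsto (fun n => gram (X n)) atTop (𝓝 S₀))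
    (hS₀ : S₀.PosDef) (i : Fin K) :
    Tendsto (fun n : ℕ => √(n : ℝ) / √(stepVar (X n) i)) atTop atTop := by
  obtain ⟨v, hv, h⟩ := tendsto_stepVar hX hS₀ i
  have h1 : Tendsto (fun n => (√(stepVar (X n) i))⁻¹) atTop (𝓝 (√v)⁻¹) :=
    (h.sqrt).inv₀ (Real.sqrt_pos.2 hv).ne'
  exact (Real.tendsto_sqrt_atTop.comp tendsto_natCast_atTop_atTop).atTop_mul_pos
    (inv_pos.2 (Real.sqrt_pos.2 hv)) h1

/-- A Lindeberg condition: the entries of the test directions tend to zero uniformly. -/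
theorem exists_abs_stepDir_le
    (hmax : Tendsto (fun n : ℕ => (⨆ i : Fin n, ‖WithLp.toLp 2 (X n i)‖) / √(n : ℝ)) atTop (𝓝 0))
    (hpd : ∀ᶠ n in atTop, ((X n)ᵀ * X n).PosDef)
    (hX : Tendsto (fun n => gram (X n)) atTop (𝓝 S₀)) (hS₀ : S₀.PosDef) :
    ∃ c : ℕ → ℝ, Tendsto c atTop (𝓝 0) ∧
      ∀ᶠ n in atTop, ∀ i r, |stepDir (X n) i r| ≤ c n := by
  set m : ℕ → ℝ := fun n => (⨆ i : Fin n, ‖WithLp.toLp 2 (X n i)‖) / √(n : ℝ) with hm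
  set d : ℕ → Fin K → ℝ := fun n i => ∑ j, |(gram (firstCols (X n) (i + 1) i.isLt))⁻¹ j
    (Fin.last i) / √(stepVar (X n) i)| with hd
  have hd0 : ∀ n i, 0 ≤ d n i := fun n i => Finset.sum_nonneg fun j _ => abs_nonneg _
  refine ⟨fun n => m n * ∑ i, d n i, ?_, ?_⟩
  · have hlim : ∀ i, ∃ L, Tendsto (fun n => d n i) atTop (𝓝 L) := fun i => by
      obtain ⟨v, hv, h⟩ := tendsto_stepVar hX hS₀ i
      have hj := fun j => tendsto_pi_nhds.1 (tendsto_pi_nhds.1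
        (tendsto_inv_gram_firstCols hX hS₀ (i + 1) i.isLt) j) (Fin.last i)
      exact ⟨_, tendsto_finsetSum _ fun j _ =>
        ((hj j).div h.sqrt (Real.sqrt_pos.2 hv).ne').abs⟩
    choose L hL using hlim
    simpa using hmax.mul (tendsto_finsetSum Finset.univ fun i _ => hL i)
  · filter_upwards [hpd, eventually_gt_atTop 0] with n hn hn0 i r
    have hrow : ∀ j, |firstCols (X n) (i + 1) i.isLt r j| ≤ ⨆ i : Fin n, ‖WithLp.toLp 2 (X n i)‖ :=
      fun j => (PiLp.norm_apply_le (WithLp.toLp 2 (X n r)) (Fin.castLE i.isLt j)).trans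
        (le_ciSup (f := fun i : Fin n => ‖WithLp.toLp 2 (X n i)‖) (Set.finite_range _).bddAbove r)
    have hm0 : 0 ≤ m n := div_nonneg (Real.iSup_nonneg fun _ => norm_nonneg _) (Real.sqrt_nonneg _)
    exact (abs_testDir_le hn0 (posDef_firstCols hn _ _) _ _ hrow).trans
      (mul_le_mul_of_nonneg_left
        (Finset.single_le_sum (f := d n) (fun i _ => hd0 n i) (Finset.mem_univ i)) hm0)

end Design

end TestDirections

/-! ### Point events of the estimators as events of the rejection pattern -/

section Deterministic

theorem sSup_eq_iff {A : Set ℕ} (hne : A.Nonempty) (hb : BddAbove A) (k : ℕ) :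
    sSup A = k ↔ k ∈ A ∧ ∀ m ∈ A, m ≤ k :=
  ⟨fun h => h ▸ ⟨Nat.sSup_mem hne hb, fun _ hm => le_csSup hb hm⟩,
    fun h => IsGreatest.csSup_eq ⟨h.1, h.2⟩⟩

theorem sInf_eq_iff {A : Set ℕ} (hne : A.Nonempty) (k : ℕ) :
    sInf A = k ↔ k ∈ A ∧ ∀ m ∈ A, k ≤ m :=
  ⟨fun h => h ▸ ⟨Nat.sInf_mem hne, fun _ hm => Nat.sInf_le hm⟩,
    fun h => IsLeast.csInf_eq ⟨h.1, h.2⟩⟩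

/-- The zero-based coordinate of the hypothesis numbered `j`. -/
def coord {k₀ K : ℕ} (j : Finset.Ioc k₀ K) : Fin K :=
  ⟨j - 1, by have := Finset.mem_Ioc.1 j.2; omega⟩

/-- The rejection pattern of the tests numbered `k₀ + 1, …, K`, for the family `t` of statistics. -/
noncomputable def nullPattern (α : ℕ → ℝ) (k₀ : ℕ) {K : ℕ} (t : Fin K → ℝ) :
    Finset.Ioc k₀ K → ℕ :=
  pattern (fun j => zUpper (α j / 2)) fun j => t (coord j)

/-- The patterns for which `k` is the last rejected hypothesis, and `k₀` counts as rejected. -/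
def lastRejected (k₀ K k : ℕ) : Set (Finset.Ioc k₀ K → ℕ) :=
  {b | k₀ ≤ k ∧ (∀ j : Finset.Ioc k₀ K, (j : ℕ) = k → b j = 1) ∧
    ∀ j : Finset.Ioc k₀ K, k < j → b j = 0}

/-- The patterns for which `k + 1` is the first accepted hypothesis after `k₀`, and `K + 1` counts
as accepted. -/
def firstAccepted (k₀ K k : ℕ) : Set (Finset.Ioc k₀ K → ℕ) :=
  {b | k₀ ≤ k ∧ (∀ j : Finset.Ioc k₀ K, (j : ℕ) ≤ k → b j = 1) ∧
    ∀ j : Finset.Ioc k₀ K, (j : ℕ) = k + 1 → b j = 0}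

variable {K k₀ : ℕ} {α : ℕ → ℝ}

theorem nullPattern_eq_one_iff (t : Fin K → ℝ) (j : Finset.Ioc k₀ K) :
    nullPattern α k₀ t j = 1 ↔ ∃ i : Fin K, (j : ℕ) = i + 1 ∧ zUpper (α j / 2) ≤ |t i| := by
  have hj := Finset.mem_Ioc.1 j.2
  have h1 : (j : ℕ) = (coord j : ℕ) + 1 := by simp only [coord]; omega
  have h2 : nullPattern α k₀ t j = 1 ↔ zUpper (α j / 2) ≤ |t (coord j)| := by
    simp [nullPattern, pattern]
  rw [h2]
  refine ⟨fun h => ⟨_, h1, h⟩, fun ⟨i, hi, h⟩ => ?_⟩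
  rwa [show coord j = i from Fin.ext (by omega)]

theorem nullPattern_eq_zero_iff (t : Fin K → ℝ) (j : Finset.Ioc k₀ K) :
    nullPattern α k₀ t j = 0 ↔ ¬ ∃ i : Fin K, (j : ℕ) = i + 1 ∧ zUpper (α j / 2) ≤ |t i| := by
  rw [← nullPattern_eq_one_iff]
  simp only [nullPattern, pattern]
  split_ifs <;> simp

variable {n : ℕ} (X : Matrix (Fin n) (Fin K) ℝ) (Y : Fin n → ℝ)

theorem kBackward_le : kBackward α X Y ≤ K := by
  refine csSup_le ⟨0, Or.inl rfl⟩ ?_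
  rintro k (rfl | ⟨i, rfl, _⟩)
  · exact Nat.zero_le _
  · exact i.isLt

theorem kForward_le : kForward α X Y ≤ K := Nat.sInf_le ⟨K + 1, rfl, Or.inl rfl⟩

theorem kOLSHard_le : kOLSHard α X Y ≤ K := by
  have := Set.ncard_le_card {i : Fin K | zUpper (α (i + 1) / 2) ≤ |zHat X Y i|}
  simpa [kOLSHard] using this

variable {X Y}

theorem kBackward_eq_iff {k : ℕ} (hk : k ≤ K) {i₀ : Fin K} (hi₀ : (i₀ : ℕ) + 1 = k₀)
    (hrej : zUpper (α k₀ / 2) ≤ |zTilde X Y i₀|) :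
    nullPattern α k₀ (zTilde X Y) ∈ lastRejected k₀ K k ↔ kBackward α X Y = k := by
  have hbdd : BddAbove {k : ℕ | k = 0 ∨ ∃ i : Fin K, k = i + 1 ∧
      zUpper (α k / 2) ≤ |zTilde X Y i|} := by
    refine ⟨K, ?_⟩
    rintro k (rfl | ⟨i, rfl, _⟩)
    · exact Nat.zero_le _
    · exact i.isLt
  rw [kBackward, sSup_eq_iff ⟨0, Or.inl rfl⟩ hbdd]
  simp only [lastRejected, Set.mem_ofPred_eq, nullPattern_eq_one_iff, nullPattern_eq_zero_iff]
  set R : ℕ → Prop := fun k => ∃ i : Fin K, k = i + 1 ∧ zUpper (α k / 2) ≤ |zTilde X Y i| with hR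
  have hR0 : R k₀ := ⟨i₀, hi₀.symm, hrej⟩
  have hRK : ∀ m, R m → m ≤ K := fun m ⟨i, hi, _⟩ => by omega
  change (k₀ ≤ k ∧ (∀ j : Finset.Ioc k₀ K, (j : ℕ) = k → R j) ∧
    ∀ j : Finset.Ioc k₀ K, k < j → ¬ R j) ↔ (k = 0 ∨ R k) ∧ ∀ m, m = 0 ∨ R m → m ≤ k
  constructor
  · rintro ⟨h1, h2, h3⟩
    have hRk : R k := by
      rcases h1.eq_or_lt with rfl | hlt
      · exact hR0
      · exact h2 ⟨k, Finset.mem_Ioc.2 ⟨hlt, hk⟩⟩ rfl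
    refine ⟨Or.inr hRk, fun m hm => ?_⟩
    rcases hm with rfl | hm
    · exact Nat.zero_le _
    · by_contra! hlt
      exact h3 ⟨m, Finset.mem_Ioc.2 ⟨h1.trans_lt hlt, hRK m hm⟩⟩ hlt hm
  · rintro ⟨h1, h2⟩
    have hle : k₀ ≤ k := h2 _ (Or.inr hR0)
    refine ⟨hle, fun j hj => ?_, fun j hj hR' => ?_⟩
    · rw [hj]
      exact h1.resolve_left fun h0 => by omega
    · have := h2 _ (Or.inr hR')
      omega

theorem kForward_eq_iff {k : ℕ} (hk : k ≤ K) (hk₀ : k₀ ≤ K)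
    (hrej : ∀ i : Fin K, (i : ℕ) < k₀ → zUpper (α (i + 1) / 2) ≤ |zTilde X Y i|) :
    nullPattern α k₀ (zTilde X Y) ∈ firstAccepted k₀ K k ↔ kForward α X Y = k := by
  rw [kForward, sInf_eq_iff (by exact ⟨K, K + 1, rfl, Or.inl rfl⟩)]
  simp only [firstAccepted, Set.mem_ofPred_eq, nullPattern_eq_one_iff, nullPattern_eq_zero_iff]
  set R : ℕ → Prop := fun k => ∃ i : Fin K, k = i + 1 ∧ zUpper (α k / 2) ≤ |zTilde X Y i| with hR
  have hR0 : ∀ m, 1 ≤ m → m ≤ k₀ → R m := fun m h1 h2 => by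
    refine ⟨⟨m - 1, by omega⟩, by simp only; omega, ?_⟩
    have h := hrej ⟨m - 1, by omega⟩ (by simp only; omega)
    simp only [Nat.sub_add_cancel h1] at h
    exact h
  have hacc : ∀ m : ℕ, (∃ i : Fin K, m = i + 1 ∧ |zTilde X Y i| < zUpper (α m / 2)) ↔
      (1 ≤ m ∧ m ≤ K ∧ ¬ R m) := fun m => by
    constructor
    · rintro ⟨i, rfl, h⟩
      refine ⟨by omega, i.isLt, ?_⟩
      rintro ⟨i', hi', h'⟩
      rw [show i' = i from Fin.ext (by omega)] at h'
      exact absurd h (not_lt.2 h')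
    · rintro ⟨h1, h2, h3⟩
      refine ⟨⟨m - 1, by omega⟩, by simp only; omega, not_le.1 fun h => h3 ⟨_, ?_, h⟩⟩
      simp only
      omega
  simp only [hacc]
  change (k₀ ≤ k ∧ (∀ j : Finset.Ioc k₀ K, (j : ℕ) ≤ k → R j) ∧
    ∀ j : Finset.Ioc k₀ K, (j : ℕ) = k + 1 → ¬ R j) ↔
    (∃ l, k = l - 1 ∧ (l = K + 1 ∨ 1 ≤ l ∧ l ≤ K ∧ ¬ R l)) ∧
      ∀ m, (∃ l, m = l - 1 ∧ (l = K + 1 ∨ 1 ≤ l ∧ l ≤ K ∧ ¬ R l)) → k ≤ m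
  constructor
  · rintro ⟨h1, h2, h3⟩
    refine ⟨⟨k + 1, rfl, ?_⟩, ?_⟩
    · rcases hk.eq_or_lt with rfl | hlt
      · exact Or.inl rfl
      · exact Or.inr ⟨by omega, hlt, h3 ⟨k + 1, Finset.mem_Ioc.2 ⟨by omega, hlt⟩⟩ rfl⟩
    · rintro m ⟨l, rfl, rfl | ⟨hl1, hlK, hl⟩⟩
      · exact hk
      · by_contra! hlt
        rcases le_or_gt l k₀ with h | h
        · exact hl (hR0 l hl1 h)
        · exact hl (h2 ⟨l, Finset.mem_Ioc.2 ⟨h, hlK⟩⟩ (by simp only; omega))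
  · rintro ⟨⟨l, hkl, hl⟩, hmin⟩
    have hall : ∀ m, 1 ≤ m → m ≤ k → R m := fun m h1 h2 => by
      by_contra hm
      have := hmin (m - 1) ⟨m, rfl, Or.inr ⟨h1, by omega, hm⟩⟩
      omega
    have hle : k₀ ≤ k := by
      rcases hl with rfl | ⟨hl1, hlK, hl⟩
      · omega
      · by_contra! hlt
        exact hl (hR0 l hl1 (by omega))
    refine ⟨hle, fun j hj => hall j ?_ hj, fun j hj hR' => ?_⟩
    · have := Finset.mem_Ioc.1 j.2
      omega
    · have hj' := Finset.mem_Ioc.1 j.2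
      rcases hl with rfl | ⟨hl1, hlK, hl⟩
      · omega
      · exact hl ((show (j : ℕ) = l by omega) ▸ hR')

theorem kOLSHard_eq_add
    (hrej : ∀ i : Fin K, (i : ℕ) < k₀ → zUpper (α (i + 1) / 2) ≤ |zHat X Y i|) (hk₀ : k₀ ≤ K) :
    kOLSHard α X Y = k₀ + ∑ j, nullPattern α k₀ (zHat X Y) j := by
  classical
  set f : ℕ → ℕ := fun m => if ∃ i : Fin K, m = i + 1 ∧ zUpper (α m / 2) ≤ |zHat X Y i|
    then 1 else 0 with hf
  have hfi : ∀ i : Fin K, f (i + 1) = if zUpper (α (i + 1) / 2) ≤ |zHat X Y i| then 1 else 0 :=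
    fun i => by
      simp only [hf]
      congr 1
      refine propext ⟨fun ⟨i', hi', h⟩ => ?_, fun h => ⟨i, rfl, h⟩⟩
      rwa [show i' = i from Fin.ext (by omega)] at h
  have h1 : kOLSHard α X Y = ∑ i : Fin K, f (i + 1) := by
    simp_rw [hfi]
    rw [kOLSHard, Set.ncard_eq_toFinset_card', Finset.sum_boole]
    simp
  have h2 : ∑ j, nullPattern α k₀ (zHat X Y) j = ∑ j ∈ Finset.Ioc k₀ K, f j := by
    rw [← Finset.sum_coe_sort (Finset.Ioc k₀ K) f]
    refine Finset.sum_congr rfl fun j _ => ?_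
    simp only [hf]
    split_ifs with h
    · exact (nullPattern_eq_one_iff _ _).2 h
    · exact (nullPattern_eq_zero_iff _ _).2 h
  have h3 : ∑ i : Fin K, f (i + 1) = ∑ j ∈ Finset.Ioc 0 K, f j := by
    rw [Fin.sum_univ_eq_sum_range fun i => f (i + 1), Finset.range_eq_Ico,
      Finset.sum_Ico_add' f 0 K 1, zero_add]
    rfl
  have h4 : ∑ j ∈ Finset.Ioc 0 k₀, f j = k₀ := by
    rw [Finset.sum_congr rfl (g := fun _ => 1) fun j hj => ?_]
    · simp
    · have hj' := Finset.mem_Ioc.1 hj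
      have h := hfi ⟨j - 1, by omega⟩
      rw [if_pos (hrej ⟨j - 1, by omega⟩ (by simp only; omega))] at h
      simpa only [Nat.sub_add_cancel hj'.1] using h
  rw [h1, h2, h3, ← Finset.sum_Ioc_consecutive _ (Nat.zero_le k₀) hk₀, h4]

end Deterministic

/-! ### The limiting law of the rejection pattern -/

theorem bernoulliLaw_real_pi (α : ℕ → unitInterval) (k₀ K : ℕ) (s : ℕ → Set ℕ) :
    (bernoulliLaw α k₀ K).real {b | ∀ j : Finset.Ioc k₀ K, b j ∈ s j} =
      ∏ j ∈ Finset.Ioc k₀ K, (bernoulliMeasure (1 : ℕ) 0 (α j)).real (s j) := by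
  have h : {b : Finset.Ioc k₀ K → ℕ | ∀ j : Finset.Ioc k₀ K, b j ∈ s j} =
      Set.univ.pi fun j : Finset.Ioc k₀ K => s j := by
    ext b
    simp
  rw [h, bernoulliLaw, measureReal_def, Measure.pi_pi, ENNReal.toReal_prod]
  exact Finset.prod_coe_sort (Finset.Ioc k₀ K) fun j =>
    (bernoulliMeasure (1 : ℕ) 0 (α j)).real (s j)

theorem bernoulliMeasure_real_one (a : unitInterval) :
    (bernoulliMeasure (1 : ℕ) 0 a).real {1} = a := by
  rw [bernoulliMeasure_real_apply _ (measurableSet_singleton _)]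
  simp

theorem bernoulliMeasure_real_zero (a : unitInterval) :
    (bernoulliMeasure (1 : ℕ) 0 a).real {0} = 1 - a := by
  rw [bernoulliMeasure_real_apply _ (measurableSet_singleton _)]
  simp

theorem bernoulliLaw_real_lastRejected (α : ℕ → unitInterval) {k₀ K k : ℕ} (hk : k ≤ K) :
    (bernoulliLaw α k₀ K).real (lastRejected k₀ K k) =
      if k < k₀ then 0
      else if k = k₀ then ∏ j ∈ Finset.Ioc k₀ K, (1 - (α j : ℝ))
      else (α k : ℝ) * ∏ j ∈ Finset.Ioc k K, (1 - (α j : ℝ)) := by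
  split_ifs with h1 h2
  · have : lastRejected k₀ K k = ∅ := Set.eq_empty_of_forall_notMem fun b hb => by
      exact absurd hb.1 (not_le.2 h1)
    rw [this, measureReal_empty]
  all_goals
    have hset : lastRejected k₀ K k = {b | ∀ j : Finset.Ioc k₀ K, b j ∈
        (if (j : ℕ) = k then {1} else if k < j then {0} else Set.univ : Set ℕ)} := by
      ext b
      simp only [lastRejected, Set.mem_ofPred_eq, not_lt.1 h1, true_and, ← forall_and]
      refine forall_congr' fun j => ?_
      split_ifs with e1 e2
      · simp [e1]
      · simp [e1, e2]
      · simp [e1, e2]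
    rw [hset, bernoulliLaw_real_pi α k₀ K fun j =>
      (if j = k then {1} else if k < j then {0} else Set.univ : Set ℕ)]
  · refine Finset.prod_congr rfl fun j hj => ?_
    have hj' := Finset.mem_Ioc.1 hj
    rw [if_neg (by omega), if_pos (by omega), bernoulliMeasure_real_zero]
  · have hlt : k₀ < k := by omega
    have hsub : Finset.Icc k K ⊆ Finset.Ioc k₀ K := fun j hj => by
      have := Finset.mem_Icc.1 hj
      exact Finset.mem_Ioc.2 ⟨by omega, this.2⟩
    rw [← Finset.prod_subset hsub fun j hj hj' => ?_, Finset.Icc_eq_cons_Ioc hk,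
      Finset.prod_cons, if_pos rfl, bernoulliMeasure_real_one]
    · congr 1
      refine Finset.prod_congr rfl fun j hj => ?_
      have hj' := Finset.mem_Ioc.1 hj
      rw [if_neg (by omega), if_pos (by omega), bernoulliMeasure_real_zero]
    · have h3 := Finset.mem_Ioc.1 hj
      have h4 : ¬ (k ≤ j ∧ j ≤ K) := fun h => hj' (Finset.mem_Icc.2 h)
      rw [if_neg (by omega), if_neg (by omega), probReal_univ]

theorem bernoulliLaw_real_firstAccepted (α : ℕ → unitInterval) {k₀ K k : ℕ} (hk : k ≤ K)
    (hαK : α (K + 1) = 0) :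
    (bernoulliLaw α k₀ K).real (firstAccepted k₀ K k) =
      if k < k₀ then 0
      else if k = k₀ then 1 - (α (k₀ + 1) : ℝ)
      else (1 - (α (k + 1) : ℝ)) * ∏ j ∈ Finset.Ioc k₀ k, (α j : ℝ) := by
  by_cases h1 : k < k₀
  · have : firstAccepted k₀ K k = ∅ := Set.eq_empty_of_forall_notMem fun b hb => by
      exact absurd hb.1 (not_le.2 h1)
    rw [this, measureReal_empty, if_pos h1]
  have hset : firstAccepted k₀ K k = {b | ∀ j : Finset.Ioc k₀ K, b j ∈
      (if (j : ℕ) ≤ k then {1} else if (j : ℕ) = k + 1 then {0} else Set.univ : Set ℕ)} := by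
    ext b
    simp only [firstAccepted, Set.mem_ofPred_eq, not_lt.1 h1, true_and, ← forall_and]
    refine forall_congr' fun j => ?_
    split_ifs with e1 e2
    · have : (j : ℕ) ≠ k + 1 := by omega
      simp [e1, this]
    · simp [e2]
    · simp [e1, e2]
  have hle : k₀ ≤ k := not_lt.1 h1
  have hmain : (bernoulliLaw α k₀ K).real (firstAccepted k₀ K k) =
      (1 - (α (k + 1) : ℝ)) * ∏ j ∈ Finset.Ioc k₀ k, (α j : ℝ) := by
    rw [hset, bernoulliLaw_real_pi α k₀ K fun j =>
      (if j ≤ k then {1} else if j = k + 1 then {0} else Set.univ : Set ℕ),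
      ← Finset.prod_Ioc_consecutive _ hle hk, mul_comm]
    congr 1
    · rcases hk.eq_or_lt with rfl | hlt
      · simp [hαK]
      · rw [Finset.prod_eq_single_of_mem (k + 1) (Finset.mem_Ioc.2 ⟨by omega, hlt⟩)
          fun j hj hj' => ?_, if_neg (by omega), if_pos rfl, bernoulliMeasure_real_zero]
        have := Finset.mem_Ioc.1 hj
        rw [if_neg (by omega), if_neg hj', probReal_univ]
    · refine Finset.prod_congr rfl fun j hj => ?_
      rw [if_pos (Finset.mem_Ioc.1 hj).2, bernoulliMeasure_real_one]
  rw [hmain, if_neg h1]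
  split_ifs with h2
  · simp [h2]
  · rfl

/-! ### Measurability of the estimators -/

section Measurability

variable {Ω : Type*} [MeasurableSpace Ω] {n K : ℕ} {Y : Ω → Fin n → ℝ}

theorem measurable_sigmaHatSq (hY : Measurable Y) (X : Matrix (Fin n) (Fin K) ℝ) :
    Measurable fun ω => sigmaHatSq X (Y ω) := by
  have : ∀ i, Measurable fun ω => Y ω i := fun i => (measurable_pi_apply i).comp hY
  simp only [sigmaHatSq, ols, Matrix.mulVec, dotProduct]
  fun_prop

theorem measurable_zTilde (hY : Measurable Y) (X : Matrix (Fin n) (Fin K) ℝ) :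
    Measurable fun ω => zTilde X (Y ω) := by
  have : ∀ i, Measurable fun ω => Y ω i := fun i => (measurable_pi_apply i).comp hY
  have hs := measurable_sigmaHatSq hY X
  refine measurable_pi_iff.2 fun i => ?_
  simp only [zTilde_eq]
  fun_prop

theorem measurable_zHat (hY : Measurable Y) (X : Matrix (Fin n) (Fin K) ℝ) :
    Measurable fun ω => zHat X (Y ω) := by
  have : ∀ i, Measurable fun ω => Y ω i := fun i => (measurable_pi_apply i).comp hY
  have hs := measurable_sigmaHatSq hY X
  refine measurable_pi_iff.2 fun i => ?_
  simp only [zHat_eq]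
  fun_prop

theorem measurable_kBackward (hY : Measurable Y) (α : ℕ → ℝ) (X : Matrix (Fin n) (Fin K) ℝ) :
    Measurable fun ω => kBackward α X (Y ω) := by
  have h := (measurable_pattern fun i : Fin K => zUpper (α (i + 1) / 2)).comp
    (measurable_zTilde hY X)
  have := (Measurable.of_discrete (f := fun b : Fin K → ℕ =>
    sSup {k : ℕ | k = 0 ∨ ∃ i : Fin K, k = i + 1 ∧ b i = 1})).comp h
  convert this using 1
  funext ω
  symm
  simp only [Function.comp_apply, kBackward, pattern]
  congr 1
  ext k
  refine or_congr Iff.rfl (exists_congr fun i => and_congr_right fun hk => ?_)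
  rw [hk]
  simp

theorem measurable_kForward (hY : Measurable Y) (α : ℕ → ℝ) (X : Matrix (Fin n) (Fin K) ℝ) :
    Measurable fun ω => kForward α X (Y ω) := by
  have h := (measurable_pattern fun i : Fin K => zUpper (α (i + 1) / 2)).comp
    (measurable_zTilde hY X)
  have := (Measurable.of_discrete (f := fun b : Fin K → ℕ =>
    sInf {j : ℕ | ∃ k : ℕ, j = k - 1 ∧ (k = K + 1 ∨ ∃ i : Fin K, k = i + 1 ∧ b i = 0)})).comp h
  convert this using 1
  funext ω
  symm
  simp only [Function.comp_apply, kForward, pattern]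
  congr 1
  ext j
  refine exists_congr fun k => and_congr_right fun _ => or_congr Iff.rfl
    (exists_congr fun i => and_congr_right fun hk => ?_)
  rw [hk]
  simp

theorem measurable_kOLSHard (hY : Measurable Y) (α : ℕ → ℝ) (X : Matrix (Fin n) (Fin K) ℝ) :
    Measurable fun ω => kOLSHard α X (Y ω) := by
  have h := (measurable_pattern fun i : Fin K => zUpper (α (i + 1) / 2)).comp
    (measurable_zHat hY X)
  have := (Measurable.of_discrete (f := fun b : Fin K → ℕ => {i : Fin K | b i = 1}.ncard)).comp h
  convert this using 1
  funext ω
  symm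
  simp only [Function.comp_apply, kOLSHard, pattern]
  congr 1
  ext i
  simp

end Measurability

/-! ### Limits of the stepwise tests -/

section Tests

open Matrix

variable {Ω : Type*} [MeasurableSpace Ω] {P : Measure Ω} [IsProbabilityMeasure P] {K : ℕ}
  {β : Fin K → ℝ} {α : ℕ → unitInterval} {X : (n : ℕ) → Matrix (Fin n) (Fin K) ℝ}
  {S₀ : Matrix (Fin K) (Fin K) ℝ} {ε : (n : ℕ) → Fin n → Ω → ℝ} {s M : ℝ}

/-- The tests of the vanishing coefficients are asymptotically independent, with exact levels. -/
theorem tendsto_measureReal_nullPattern_mem {k₀ : ℕ} (hβ : ∀ i : Fin K, k₀ ≤ i → β i = 0)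
    (hα : ∀ j ∈ Finset.Ioc k₀ K, 0 < α j)
    (hmax : Tendsto (fun n : ℕ => (⨆ i : Fin n, ‖WithLp.toLp 2 (X n i)‖) / √(n : ℝ)) atTop (𝓝 0))
    (hpd : ∀ᶠ n in atTop, ((X n)ᵀ * X n).PosDef)
    (hX : Tendsto (fun n => gram (X n)) atTop (𝓝 S₀)) (hS₀ : S₀.PosDef) (hs : 0 < s)
    (hεm : ∀ n i, Measurable (ε n i)) (hεi : ∀ n, iIndepFun (ε n) P)
    (hε4 : ∀ n i, MemLp (ε n i) 4 P) (h1 : ∀ n i, ∫ ω, ε n i ω ∂P = 0)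
    (h2 : ∀ n i, ∫ ω, ε n i ω ^ 2 ∂P = s ^ 2) (hM : ∀ n i, ∫ ω, ε n i ω ^ 4 ∂P ≤ M)
    (hS : TendstoInMeasure P
      (fun n ω => √(sigmaHatSq (X n) fun i => (X n).mulVec β i + ε n i ω)) atTop (fun _ => s))
    (B : Set (Finset.Ioc k₀ K → ℕ)) :
    Tendsto (fun n => P.real {ω | nullPattern (fun k => (α k : ℝ)) k₀
        (zTilde (X n) fun i => (X n).mulVec β i + ε n i ω) ∈ B}) atTop
      (𝓝 ((bernoulliLaw α k₀ K).real B)) := by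
  obtain ⟨c, hc, hcb⟩ := exists_abs_stepDir_le hmax hpd hX hS₀
  have hcoord : Function.Injective (coord : Finset.Ioc k₀ K → Fin K) := fun j l h => by
    have hj := Finset.mem_Ioc.1 j.2
    have hl := Finset.mem_Ioc.1 l.2
    have := congrArg Fin.val h
    simp only [coord] at this
    exact Subtype.ext (by omega)
  have hclt := tendstoInDistribution_orthonormal_sums
    (u := fun n (j : Finset.Ioc k₀ K) => stepDir (X n) (coord j)) hεm hεi hε4 h1 h2 hM
    (by
      filter_upwards [hpd, eventually_gt_atTop 0] with n hn hn0 j l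
      rw [sum_stepDir_mul_stepDir hn0 hn]
      simp only [hcoord.eq_iff]) hc
    (by
      filter_upwards [hcb] with n hn j i
      exact hn _ _)
  have hYm : ∀ n, Measurable fun ω => fun i => (X n).mulVec β i + ε n i ω := fun n =>
    measurable_pi_iff.2 fun i => (hεm n i).const_add _
  have hlim := tendsto_measureReal_pattern_mem hs hclt
    (fun n => (measurable_sigmaHatSq (hYm n) (X n)).sqrt) hS
    (fun j : Finset.Ioc k₀ K => zUpper ((α j : ℝ) / 2)) B
  have hlaw : (Measure.pi fun _ : Finset.Ioc k₀ K => gaussianReal 0 1).real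
      {x | pattern (fun j : Finset.Ioc k₀ K => zUpper ((α j : ℝ) / 2)) x ∈ B} =
      (bernoulliLaw α k₀ K).real B := by
    rw [bernoulliLaw, ← map_pattern_gaussian (fun j : Finset.Ioc k₀ K => α j)
      fun j => hα j j.2, map_measureReal_apply (measurable_pattern _)
        (Set.to_countable B).measurableSet]
    rfl
  rw [hlaw] at hlim
  refine tendsto_measureReal_of_iff_on
    (G := fun n => {ω | √(sigmaHatSq (X n) fun i => (X n).mulVec β i + ε n i ω) ≤ 0}ᶜ)
    ?_ ?_ hlim
  · filter_upwards [hpd, eventually_gt_atTop 0] with n hn hn0 ω hω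
    have hpos : 0 < √(sigmaHatSq (X n) fun i => (X n).mulVec β i + ε n i ω) := not_le.1 hω
    have hstat : ∀ j : Finset.Ioc k₀ K,
        zTilde (X n) (fun i => (X n).mulVec β i + ε n i ω) (coord j) =
          (∑ i, stepDir (X n) (coord j) i * ε n i ω) /
            √(sigmaHatSq (X n) fun i => (X n).mulVec β i + ε n i ω) := fun j => by
      have hj := Finset.mem_Ioc.1 j.2
      have hle : k₀ ≤ (coord j : ℕ) := by simp only [coord]; omega
      rw [zTilde_eq]
      congr 1
      simp_rw [mul_add]
      rw [Finset.sum_add_distrib, sum_stepDir_mul_mulVec hn0 hn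
        (Or.inl fun i hi => hβ i (hle.trans (Fin.lt_def.1 hi).le)), hβ _ hle, zero_mul, zero_add]
    have : nullPattern (fun k => (α k : ℝ)) k₀
        (zTilde (X n) fun i => (X n).mulVec β i + ε n i ω) =
        pattern (fun j : Finset.Ioc k₀ K => zUpper ((α j : ℝ) / 2) *
          √(sigmaHatSq (X n) fun i => (X n).mulVec β i + ε n i ω))
          (fun j => ∑ i, stepDir (X n) (coord j) i * ε n i ω) := by
      funext j
      simp only [nullPattern, pattern, hstat, abs_div, abs_of_pos hpos, le_div_iff₀ hpos]
    simp only [this]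
  · simp only [compl_compl]
    exact tendsto_measureReal_nonpos hs hS

/-- The test of a nonzero coefficient rejects with probability tending to one. -/
theorem tendsto_measureReal_not_reject {i : Fin K} (hβ : β i ≠ 0)
    (hi : (∀ j, i < j → β j = 0) ∨ ∀ᶠ n in atTop, gram (X n) = 1)
    (hα : 0 < α (i + 1)) (hpd : ∀ᶠ n in atTop, ((X n)ᵀ * X n).PosDef)
    (hX : Tendsto (fun n => gram (X n)) atTop (𝓝 S₀)) (hS₀ : S₀.PosDef) (hs : 0 < s)
    (hεi : ∀ n, iIndepFun (ε n) P) (hε4 : ∀ n i, MemLp (ε n i) 4 P)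
    (h1 : ∀ n i, ∫ ω, ε n i ω ∂P = 0) (h2 : ∀ n i, ∫ ω, ε n i ω ^ 2 ∂P = s ^ 2)
    (hS : TendstoInMeasure P
      (fun n ω => √(sigmaHatSq (X n) fun i => (X n).mulVec β i + ε n i ω)) atTop (fun _ => s)) :
    Tendsto (fun n => P.real {ω | ¬ zUpper ((α (i + 1) : ℝ) / 2) ≤
      |zTilde (X n) (fun i => (X n).mulVec β i + ε n i ω) i|}) atTop (𝓝 0) := by
  have hm : Tendsto (fun n : ℕ => |β i * (√(n : ℝ) / √(stepVar (X n) i))|) atTop atTop := by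
    simp_rw [abs_mul]
    exact (tendsto_abs_atTop_atTop.comp (tendsto_sqrt_div_sqrt_stepVar hX hS₀ i)).const_mul_atTop
      (abs_pos.2 hβ)
  have hα0 : (0 : ℝ) < α (i + 1) := hα
  have hacc := tendsto_measureReal_accept (N := fun n ω => ∑ r, stepDir (X n) i r * ε n r ω)
    (v := s ^ 2) hs hS (zUpper_nonneg (p := (α (i + 1) : ℝ) / 2) (by linarith)
      (by linarith [(α (i + 1)).2.2])) hm
    (fun n => memLp_finsetSum _ fun r _ => (memLp_two_of_four (hε4 n r)).const_mul _)
    (by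
      filter_upwards [hpd, eventually_gt_atTop 0] with n hn hn0
      rw [integral_sum_mul_sq (fun r => memLp_two_of_four (hε4 n r)) (hεi n) (h1 n) (h2 n)]
      have := sum_stepDir_mul_stepDir hn0 hn i i
      simp only [← sq, if_true] at this
      rw [this, mul_one])
  refine tendsto_measureReal_of_iff_on
    (G := fun n => {ω | √(sigmaHatSq (X n) fun i => (X n).mulVec β i + ε n i ω) ≤ 0}ᶜ)
    ?_ ?_ hacc
  · have hi' : ∀ᶠ n in atTop, (∀ j, i < j → β j = 0) ∨ gram (X n) = 1 := by
      rcases hi with h | h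
      · exact Eventually.of_forall fun n => Or.inl h
      · exact h.mono fun n hn => Or.inr hn
    filter_upwards [hpd, eventually_gt_atTop 0, hi'] with n hn hn0 hin ω hω
    have hpos : 0 < √(sigmaHatSq (X n) fun i => (X n).mulVec β i + ε n i ω) := not_le.1 hω
    rw [zTilde_eq, abs_div, abs_of_pos hpos, le_div_iff₀ hpos, not_le]
    simp_rw [mul_add]
    rw [Finset.sum_add_distrib, sum_stepDir_mul_mulVec hn0 hn hin]
  · simp only [compl_compl]
    exact tendsto_measureReal_nonpos hs hS

end Tests

end Stepwise

theorem theorem8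
    {Ω : Type*} [MeasurableSpace Ω] (P : Measure Ω) [IsProbabilityMeasure P]
    (K k₀ : ℕ) (hk₀ : 1 ≤ k₀) (hk₀K : k₀ ≤ K)
    -- the true coefficients: the first `k₀` are nonzero, the others are zero
    (β₀ : Fin K → ℝ) (hβ₀ : ∀ i : Fin K, β₀ i ≠ 0 ↔ (i : ℕ) < k₀)
    -- significance levels `α_1, …, α_K`, with the convention `α_{K+1} = 0`
    (α : ℕ → unitInterval) (hα : ∀ k ∈ Finset.Icc 1 K, 0 < α k) (hαK : α (K + 1) = 0)
    -- the design matrices, with (D1)-(D4)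
    (X : (n : ℕ) → Matrix (Fin n) (Fin K) ℝ) (S₀ : Matrix (Fin K) (Fin K) ℝ)
    (hD1 : ∀ᶠ n in atTop, ∀ k, ∑ i, X n i k = 0 ∧ ∑ i, X n i k ^ 2 = (n : ℝ))
    (hD2 : Tendsto (fun n : ℕ => (⨆ i : Fin n, ‖WithLp.toLp 2 (X n i)‖) / Real.sqrt n)
      atTop (𝓝 0))
    (hD3 : ∀ᶠ n in atTop, ((X n).transpose * X n).PosDef)
    (hD4 : Tendsto (fun n => Stepwise.gram (X n)) atTop (𝓝 S₀)) (hS₀ : S₀.PosDef)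
    -- the errors: independent in each row, centered, with variance `σ₀²` and bounded fourth moment
    (ε : (n : ℕ) → Fin n → Ω → ℝ) (σ₀ M : ℝ) (hσ₀ : 0 < σ₀)
    (hεm : ∀ n i, Measurable (ε n i)) (hεi : ∀ n, iIndepFun (ε n) P)
    (hε4 : ∀ n i, MemLp (ε n i) 4 P)
    (hεmean : ∀ n i, ∫ ω, ε n i ω ∂P = 0)
    (hεvar : ∀ n i, ∫ ω, ε n i ω ^ 2 ∂P = σ₀ ^ 2)
    (hεM : ∀ n i, ∫ ω, ε n i ω ^ 4 ∂P ≤ M)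
    -- the responses
    (Y : (n : ℕ) → Ω → Fin n → ℝ)
    (hY : ∀ n ω i, Y n ω i = (X n).mulVec β₀ i + ε n i ω) :
    -- (a) backward stepwise
    (∃ kB : ProbabilityMeasure ℕ,
      TendstoInDistribution (fun n ω => Stepwise.kBackward (fun k => (α k : ℝ)) (X n) (Y n ω))
        atTop (id : ℕ → ℕ) (fun _ => P) (kB : Measure ℕ) ∧
      ∀ k ≤ K, (kB : Measure ℕ).real {k} =
        if k < k₀ then 0
        else if k = k₀ then ∏ j ∈ Finset.Ioc k₀ K, (1 - (α j : ℝ))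
        else (α k : ℝ) * ∏ j ∈ Finset.Ioc k K, (1 - (α j : ℝ))) ∧
    -- (b), (c) forward stepwise and OLS-hard under an orthogonal design
    ((∀ᶠ n in atTop, Stepwise.gram (X n) = 1) → S₀ = 1 →
      (∃ kF : ProbabilityMeasure ℕ,
        TendstoInDistribution (fun n ω => Stepwise.kForward (fun k => (α k : ℝ)) (X n) (Y n ω))
          atTop (id : ℕ → ℕ) (fun _ => P) (kF : Measure ℕ) ∧
        ∀ k ≤ K, (kF : Measure ℕ).real {k} =
          if k < k₀ then 0
          else if k = k₀ then 1 - (α (k₀ + 1) : ℝ)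
          else (1 - (α (k + 1) : ℝ)) * ∏ j ∈ Finset.Ioc k₀ k, (α j : ℝ)) ∧
      (∃ kO : ProbabilityMeasure ℕ,
        TendstoInDistribution (fun n ω => Stepwise.kOLSHard (fun k => (α k : ℝ)) (X n) (Y n ω))
          atTop (id : ℕ → ℕ) (fun _ => P) (kO : Measure ℕ) ∧
        ∀ k ≤ K, (kO : Measure ℕ).real {k} =
          if k < k₀ then 0
          else (Stepwise.bernoulliLaw α k₀ K).real {b | ∑ j, b j = k - k₀})) := by
  obtain rfl : Y = fun n ω i => (X n).mulVec β₀ i + ε n i ω :=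
    funext fun n => funext fun ω => funext fun i => hY n ω i
  have hYm : ∀ n, Measurable fun ω => fun i => (X n).mulVec β₀ i + ε n i ω := fun n =>
    measurable_pi_iff.2 fun i => (hεm n i).const_add _
  have hβz : ∀ i : Fin K, k₀ ≤ i → β₀ i = 0 := fun i hi => by
    by_contra h
    exact absurd ((hβ₀ i).1 h) (not_lt.2 hi)
  have hS : TendstoInMeasure P
      (fun n ω => √(Stepwise.sigmaHatSq (X n) fun i => (X n).mulVec β₀ i + ε n i ω)) atTop
      (fun _ => σ₀) :=
    Stepwise.tendstoInMeasure_sqrt_sigmaHatSq β₀ (hD1.mono fun n hn k => (hn k).2) hD3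
      (Stepwise.tendsto_inv_of_posDef hS₀ hD4) hσ₀ hεi hε4 hεmean hεvar hεM
  have hnull := Stepwise.tendsto_measureReal_nullPattern_mem hβz
    (fun j hj => hα j (Finset.mem_Icc.2
      ⟨by have := Finset.mem_Ioc.1 hj; omega, (Finset.mem_Ioc.1 hj).2⟩))
    hD2 hD3 hD4 hS₀ hσ₀ hεm hεi hε4 hεmean hεvar hεM hS
  have hrej : ∀ i : Fin K, (i : ℕ) < k₀ →
      ((∀ j, i < j → β₀ j = 0) ∨ ∀ᶠ n in atTop, Stepwise.gram (X n) = 1) →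
      Tendsto (fun n => P.real {ω | ¬ Stepwise.zUpper ((α (i + 1) : ℝ) / 2) ≤
        |Stepwise.zTilde (X n) (fun i => (X n).mulVec β₀ i + ε n i ω) i|}) atTop (𝓝 0) :=
    fun i hi h => Stepwise.tendsto_measureReal_not_reject ((hβ₀ i).2 hi) h
      (hα _ (Finset.mem_Icc.2 ⟨by omega, i.isLt⟩)) hD3 hD4 hS₀ hσ₀ hεi hε4 hεmean hεvar hS
  refine ⟨?_, fun horth _ => ?_⟩
  · refine Stepwise.exists_tendstoInDistribution_nat
      (fun n => Stepwise.measurable_kBackward (hYm n) _ (X n))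
      (fun n ω => Stepwise.kBackward_le _ _) fun k hk => ?_
    rw [← Stepwise.bernoulliLaw_real_lastRejected α hk]
    set i₀ : Fin K := ⟨k₀ - 1, by omega⟩ with hi₀
    have hi₀v : (i₀ : ℕ) + 1 = k₀ := by simp only [hi₀]; omega
    refine Stepwise.tendsto_measureReal_of_iff_on
      (G := fun n => {ω | ¬ Stepwise.zUpper ((α (i₀ + 1) : ℝ) / 2) ≤
        |Stepwise.zTilde (X n) (fun i => (X n).mulVec β₀ i + ε n i ω) i₀|}ᶜ)
      (Eventually.of_forall fun n ω hω => ?_) ?_ (hnull (Stepwise.lastRejected k₀ K k))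
    · refine Stepwise.kBackward_eq_iff hk hi₀v ?_
      have hω' := not_not.1 hω
      rwa [hi₀v] at hω'
    · simp only [compl_compl]
      refine hrej i₀ (by omega) (Or.inl fun j hj => hβz j ?_)
      have := Fin.lt_def.1 hj
      omega
  ·
    -- In both parts it suffices to argue on the event that all nonzero coefficients are detected.
    set G : ℕ → Set Ω := fun n => {ω | ∀ i : Fin K, (i : ℕ) < k₀ →
      Stepwise.zUpper ((α (i + 1) : ℝ) / 2) ≤
        |Stepwise.zTilde (X n) (fun i => (X n).mulVec β₀ i + ε n i ω) i|} with hG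
    have hGc : Tendsto (fun n => P.real (G n)ᶜ) atTop (𝓝 0) := by
      have hsum : Tendsto (fun n => ∑ i ∈ Finset.univ.filter fun i : Fin K => (i : ℕ) < k₀,
          P.real {ω | ¬ Stepwise.zUpper ((α (i + 1) : ℝ) / 2) ≤
            |Stepwise.zTilde (X n) (fun i => (X n).mulVec β₀ i + ε n i ω) i|}) atTop (𝓝 0) := by
        have := tendsto_finsetSum (Finset.univ.filter fun i : Fin K => (i : ℕ) < k₀)
          fun i hi => hrej i (Finset.mem_filter.1 hi).2 (Or.inr horth)
        simpa using this
      refine squeeze_zero (fun _ => measureReal_nonneg) (fun n => ?_) hsum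
      refine (measureReal_mono (fun ω hω => ?_) (measure_ne_top _ _)).trans
        (measureReal_biUnion_finset_le _ _)
      simp only [hG, Set.mem_compl_iff, Set.mem_ofPred_eq, not_forall] at hω
      obtain ⟨i, hi, h⟩ := hω
      exact Set.mem_biUnion (Finset.mem_coe.2 (Finset.mem_filter.2 ⟨Finset.mem_univ i, hi⟩)) h
    constructor
    · refine Stepwise.exists_tendstoInDistribution_nat
        (fun n => Stepwise.measurable_kForward (hYm n) _ (X n))
        (fun n ω => Stepwise.kForward_le _ _) fun k hk => ?_
      rw [← Stepwise.bernoulliLaw_real_firstAccepted α hk hαK]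
      exact Stepwise.tendsto_measureReal_of_iff_on
        (Eventually.of_forall fun n ω hω => Stepwise.kForward_eq_iff hk hk₀K hω) hGc
        (hnull (Stepwise.firstAccepted k₀ K k))
    · refine Stepwise.exists_tendstoInDistribution_nat
        (fun n => Stepwise.measurable_kOLSHard (hYm n) _ (X n))
        (fun n ω => Stepwise.kOLSHard_le _ _) fun k hk => ?_
      have hset : (if k < k₀ then 0 else
          (Stepwise.bernoulliLaw α k₀ K).real {b | ∑ j, b j = k - k₀}) =
          (Stepwise.bernoulliLaw α k₀ K).real {b | k₀ + ∑ j, b j = k} := by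
        split_ifs with h
        · rw [show {b : Finset.Ioc k₀ K → ℕ | k₀ + ∑ j, b j = k} = ∅ from
            Set.eq_empty_of_forall_notMem fun b (hb : _ = k) => by omega, measureReal_empty]
        · congr 1
          ext b
          simp only [Set.mem_ofPred_eq]
          omega
      rw [hset]
      refine Stepwise.tendsto_measureReal_of_iff_on ?_ hGc (hnull {b | k₀ + ∑ j, b j = k})
      filter_upwards [horth, eventually_gt_atTop 0] with n hn hn0 ω hω
      have hz : Stepwise.zTilde (X n) (fun i => (X n).mulVec β₀ i + ε n i ω) =
          Stepwise.zHat (X n) fun i => (X n).mulVec β₀ i + ε n i ω :=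
        funext fun i => Stepwise.zTilde_eq_zHat hn0 hn _ i
      simp only [hG, Set.mem_ofPred_eq, hz] at hω ⊢
      rw [Stepwise.kOLSHard_eq_add hω hk₀K]
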